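/- **Proposition 3.1.** Let $d,r,N\ge 1$ be integers, $T>0$, $\rho>0$, $h:=T/N$, and $t_k:=kh$ for $k=0,\dots,N$. Let $\mathcal P_1(\mathbb R^d)$ be the set of Borel probability measures on $\mathbb R^d$ with finite first moment, with the distance $d_1(\mu,\nu)=\inf_\gamma\int|x-y|\,d\gamma(x,y)$ (infimum over all transport plans $\gamma$ between $\mu$ and $\nu$), and let $C([0,T];\mathcal P_1(\mathbb R^d))$ carry the topology of uniform convergence. Let $$b:C([0,T];\mathcal P_1(\mathbb R^d))\times\mathbb R^d\times[0,T]\to\mathbb R^d,\qquad \sigma:C([0,T];\mathcal P_1(\mathbb R^d))\times\mathbb R^d\times[0,T]\to\mathbb R^{d\times r}$$ be continuous and assume that there is $C>0$ with $|b[\mu](x,t)|+|\sigma[\mu](x,t)|\le C(1+|x|)$ for all $\mu,x,t$. For $i\in\mathbb Z^d$ let $x_i:=\rho i$, let $E_i:=\{x:\ |x-x_i|_\infty\le\rho/2\}$, and let $\beta_i(x):=\prod_{l=1}^d\max\{1-|x^l-x_i^l|/\rho,\,0\}$ be the $\mathbb Q_1$ basis function of the cubic lattice with vertices $\rho\mathbb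 Z^d$. Let $\bar m_0$ be a probability measure on $\mathbb R^d$ with finite second moment and $\bar m_0(\partial E_i)=0$ for all $i$. Let $\mathcal S^{\rho,h}$ be the set of families $(\mu_{i,k})_{i\in\mathbb Z^d,\,0\le k\le N}$ with $\mu_{i,k}\ge 0$, $\sum_i\mu_{i,k}=1$ and $\sum_i|x_i|\mu_{i,k}<\infty$ for every $k$. Identify $\mu\in\mathcal S^{\rho,h}$ with the curve in $C([0,T];\mathcal P_1(\mathbb R^d))$ given by $$\mu(t)=\frac{t-t_k}{h}\sum_i\mu_{i,k+1}\delta_{x_i}+\frac{t_{k+1}-t}{h}\sum_i\mu_{i,k}\delta_{x_i},\qquad t\in[t_k,t_{k+1}],\ k=0,\dots,N-1.$$ Writing $\sigma_\ell$ for the $\ell$-th column of $\sigma$, set $\Phi_{j,k}^{\ell,\pm}[\mu]:=x_j+h\,b[\mu](x_j,t_k)\pm\sqrt{rh}\,\sigma_\ell[\mu](x_j,t_k)$, and let $\mathcal F^{\rho,h}(\mu)=(m_{i,k}[\mu])_{i,k}$ be defined by $m_{i,0}[\mu]:=\bar m_0(E_i)$ and, for $k=0,\dots,N-1$, $$m_{i,k+1}[\mu]:=\frac1{2r}\sum_{\ell=1}^r\sum_{j\in\mathbb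 Z^d}\bigl[\beta_i(\Phi_{j,k}^{\ell,+}[\mu])+\beta_i(\Phi_{j,k}^{\ell,-}[\mu])\bigr]\,m_{j,k}[\mu].$$ Then $\mathcal F^{\rho,h}$ maps $\mathcal S^{\rho,h}$ into $\mathcal S^{\rho,h}$, and there exists at least one $m\in\mathcal S^{\rho,h}$ with $m=\mathcal F^{\rho,h}(m)$. -/

import Mathlib

open MeasureTheory ProbabilityTheory Filter Topology
open scoped ENNReal

noncomputable section

namespace FPK

/-- Euclidean space of dimension `d`, with the Euclidean norm. -/
abbrev Euc (d : ℕ) := EuclideanSpace ℝ (Fin d)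

/-! ### Probability measures with finite first moment and the distance of optimal transport -/

/-- Probability measures on Euclidean space with finite first moment. (A structure, so that it
does not inherit the topology of weak convergence; its topology is the one of `d₁` below.) -/
structure P1 (d : ℕ) where
  /-- the underlying measure -/
  meas : Measure (Euc d)
  isProb : IsProbabilityMeasure meas
  moment : ∫⁻ x, ‖x‖ₑ ∂meas < ∞

instance instIsProb {d : ℕ} (μ : P1 d) : IsProbabilityMeasure μ.meas := μ.isProb

/-- `γ` is a transport plan between `μ` and `ν`: its two marginals are `μ` and `ν`. -/
def IsCoupling {d : ℕ} (μ ν : Measure (Euc d)) (γ : Measure (Euc d × Euc d)) : Prop :=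
  γ.map Prod.fst = μ ∧ γ.map Prod.snd = ν

/-- The distance `d₁ (μ, ν) = inf ∫ |x - y| dγ (x, y)` over all transport plans `γ`. -/
def dist1 {d : ℕ} (μ ν : Measure (Euc d)) : ℝ≥0∞ :=
  ⨅ (γ : Measure (Euc d × Euc d)) (_ : IsCoupling μ ν γ), ∫⁻ p, edist p.1 p.2 ∂γ

theorem dist1_self {d : ℕ} (μ : Measure (Euc d)) : dist1 μ μ = 0 := by
  refine le_antisymm ?_ zero_le
  have hc : IsCoupling μ μ (μ.map fun x => (x, x)) := by
    constructor
    · rw [Measure.map_map (by fun_prop) (by fun_prop)]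
      exact Measure.map_id
    · rw [Measure.map_map (by fun_prop) (by fun_prop)]
      exact Measure.map_id
  refine (iInf₂_le _ hc).trans ?_
  rw [lintegral_map (by fun_prop) (by fun_prop)]
  simp

theorem IsCoupling.swap {d : ℕ} {μ ν : Measure (Euc d)} {γ : Measure (Euc d × Euc d)}
    (h : IsCoupling μ ν γ) : IsCoupling ν μ (γ.map Prod.swap) := by
  constructor
  · rw [Measure.map_map (by fun_prop) (by fun_prop)]
    exact h.2
  · rw [Measure.map_map (by fun_prop) (by fun_prop)]
    exact h.1

theorem dist1_comm_le {d : ℕ} (μ ν : Measure (Euc d)) : dist1 μ ν ≤ dist1 ν μ := by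
  refine le_iInf₂ fun γ hγ => (iInf₂_le _ hγ.swap).trans ?_
  rw [lintegral_map (by fun_prop) (by fun_prop)]
  simp [edist_comm]

theorem IsCoupling.isProb {d : ℕ} {μ ν : Measure (Euc d)} [IsProbabilityMeasure μ]
    {γ : Measure (Euc d × Euc d)} (h : IsCoupling μ ν γ) : IsProbabilityMeasure γ := by
  constructor
  have h1 : γ.map Prod.fst Set.univ = 1 := by rw [h.1]; exact measure_univ
  rwa [Measure.map_apply measurable_fst MeasurableSet.univ, Set.preimage_univ] at h1

/-- Gluing of transport plans. -/
theorem dist1_triangle {d : ℕ} (μ ν η : Measure (Euc d)) [IsProbabilityMeasure μ]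
    [IsProbabilityMeasure ν] : dist1 μ η ≤ dist1 μ ν + dist1 ν η := by
  unfold dist1
  refine ENNReal.le_iInf₂_add_iInf₂ fun γ₁ h₁ γ₂ h₂ => ?_
  have hp₁ := h₁.isProb
  have hp₂ := h₂.isProb
  have hs := h₁.swap
  have hps := hs.isProb
  set γ₁' := γ₁.map Prod.swap with hγ₁'
  set θ : Measure (Euc d × (Euc d × Euc d)) := ν ⊗ₘ (γ₁'.condKernel ×ₖ γ₂.condKernel) with hθ
  have e₁ : θ.map (Prod.map id Prod.fst) = γ₁' := by
    rw [hθ, ← Measure.compProd_map measurable_fst, ← Kernel.fst_eq, Kernel.fst_prod]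
    conv_rhs => rw [← γ₁'.disintegrate γ₁'.condKernel]
    rw [Measure.fst, hs.1]
  have e₂ : θ.map (Prod.map id Prod.snd) = γ₂ := by
    rw [hθ, ← Measure.compProd_map measurable_snd, ← Kernel.snd_eq, Kernel.snd_prod]
    conv_rhs => rw [← γ₂.disintegrate γ₂.condKernel]
    rw [Measure.fst, h₂.1]
  have hc : IsCoupling μ η (θ.map Prod.snd) := by
    constructor
    · rw [← hs.2, ← e₁, Measure.map_map (by fun_prop) (by fun_prop),
        Measure.map_map (by fun_prop) (by fun_prop)]
      rfl
    · rw [← h₂.2]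
      conv_rhs => rw [← e₂]
      rw [Measure.map_map (by fun_prop) (by fun_prop),
        Measure.map_map (by fun_prop) (by fun_prop)]
      rfl
  refine (iInf₂_le _ hc).trans ?_
  · have c₁ : ∫⁻ p, edist p.1 p.2 ∂γ₁ = ∫⁻ z, edist z.2.1 z.1 ∂θ := by
      have : ∫⁻ p, edist p.1 p.2 ∂γ₁ = ∫⁻ p, edist p.2 p.1 ∂γ₁' := by
        rw [hγ₁', lintegral_map (by fun_prop) (by fun_prop)]
        rfl
      rw [this, ← e₁, lintegral_map (by fun_prop) (by fun_prop)]
      rfl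
    have c₂ : ∫⁻ p, edist p.1 p.2 ∂γ₂ = ∫⁻ z, edist z.1 z.2.2 ∂θ := by
      conv_lhs => rw [← e₂]
      rw [lintegral_map (by fun_prop) (by fun_prop)]
      rfl
    rw [c₁, c₂, ← lintegral_add_left (by fun_prop), lintegral_map (by fun_prop) (by fun_prop)]
    exact lintegral_mono fun z => edist_triangle _ _ _

/-- The space of probability measures with finite first moment carries the distance `d₁`
and the topology induced by it. -/
instance instPseudoEMetricSpace (d : ℕ) : PseudoEMetricSpace (P1 d) where
  edist μ ν := dist1 μ.meas ν.meas
  edist_self μ := dist1_self μ.meas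
  edist_comm μ ν := le_antisymm (dist1_comm_le _ _) (dist1_comm_le _ _)
  edist_triangle μ ν η := dist1_triangle μ.meas ν.meas η.meas

/-- The space of continuous curves `[0,T] → P1`, with the topology of uniform convergence
(Mathlib's compact-open topology on continuous maps, the interval being compact). -/
abbrev Curves (d : ℕ) (T : ℝ) := C(Set.Icc (0 : ℝ) T, P1 d)

/-- Two measures with a common part `c` are close if the remaining parts have small moments. -/
theorem dist1_le_of_add {d : ℕ} {μ ν c p q : Measure (Euc d)} [IsProbabilityMeasure μ]
    [IsProbabilityMeasure ν] (hμ : μ = c + p) (hν : ν = c + q) :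
    dist1 μ ν ≤ ∫⁻ x, ‖x‖ₑ ∂p + ∫⁻ x, ‖x‖ₑ ∂q := by
  have hcμ : c Set.univ + p Set.univ = 1 := by
    rw [← Measure.add_apply, ← hμ]; exact measure_univ
  have hcν : c Set.univ + q Set.univ = 1 := by
    rw [← Measure.add_apply, ← hν]; exact measure_univ
  have hcf : c Set.univ ≠ ∞ := fun h => by simp [h] at hcμ
  have hpf : p Set.univ ≠ ∞ := fun h => by simp [h] at hcμ
  have hpq : p Set.univ = q Set.univ :=
    (ENNReal.add_right_inj hcf).1 (hcμ.trans hcν.symm)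
  have : IsFiniteMeasure p := ⟨hpf.lt_top⟩
  have : IsFiniteMeasure q := ⟨by rw [← hpq]; exact hpf.lt_top⟩
  have key : ∀ r : Measure (Euc d), r Set.univ = p Set.univ →
      ((p Set.univ)⁻¹ * p Set.univ) • r = r := by
    intro r hr
    by_cases h0 : p Set.univ = 0
    · rw [h0, Measure.measure_univ_eq_zero] at hr
      simp [hr]
    · rw [ENNReal.inv_mul_cancel h0 hpf, one_smul]
  have hc : IsCoupling μ ν (c.map (fun x => (x, x)) + (p Set.univ)⁻¹ • p.prod q) := by
    constructor
    · rw [Measure.map_add _ _ measurable_fst, Measure.map_map (by fun_prop) (by fun_prop),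
        Measure.map_smul, Measure.map_fst_prod, ← hpq, smul_smul, key p rfl, hμ]
      congr 1
      exact Measure.map_id
    · rw [Measure.map_add _ _ measurable_snd, Measure.map_map (by fun_prop) (by fun_prop),
        Measure.map_smul, Measure.map_snd_prod, smul_smul, key q hpq.symm, hν]
      congr 1
      exact Measure.map_id
  refine (iInf₂_le _ hc).trans ?_
  · rw [lintegral_add_measure, lintegral_map (by fun_prop) (by fun_prop), lintegral_smul_measure]
    simp only [edist_self, lintegral_zero, zero_add]
    have h1 : ∫⁻ z, edist z.1 z.2 ∂(p.prod q) ≤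
        p Set.univ * (∫⁻ x, ‖x‖ₑ ∂p + ∫⁻ x, ‖x‖ₑ ∂q) := by
      calc ∫⁻ z, edist z.1 z.2 ∂(p.prod q)
          ≤ ∫⁻ z, (‖z.1‖ₑ + ‖z.2‖ₑ) ∂(p.prod q) := by
            refine lintegral_mono fun z => ?_
            rw [edist_eq_enorm_sub]
            exact enorm_sub_le
        _ = ∫⁻ x, ∫⁻ y, (‖x‖ₑ + ‖y‖ₑ) ∂q ∂p :=
            lintegral_prod _ (by fun_prop)
        _ = _ := by
            simp_rw [lintegral_add_left measurable_const, lintegral_const]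
            rw [lintegral_add_right _ measurable_const, lintegral_mul_const _ (by fun_prop),
              lintegral_const, ← hpq]
            ring
    calc (p Set.univ)⁻¹ • ∫⁻ z, edist z.1 z.2 ∂(p.prod q)
        ≤ (p Set.univ)⁻¹ * (p Set.univ * (∫⁻ x, ‖x‖ₑ ∂p + ∫⁻ x, ‖x‖ₑ ∂q)) := by
          rw [smul_eq_mul]; gcongr
      _ ≤ _ := by
          rw [← mul_assoc]
          exact mul_le_of_le_one_left zero_le (ENNReal.inv_mul_le_one _)

/-! ### Space grid -/

/-- The grid point `x_i = ρ i`, for `i ∈ ℤ^d`. -/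
def gridPoint {d : ℕ} (ρ : ℝ) (i : Fin d → ℤ) : Euc d :=
  WithLp.toLp 2 fun l => ρ * (i l : ℝ)

/-- The closed cube `E_i` of side `ρ` centred at `x_i`, a ball of the sup norm. -/
def cube {d : ℕ} (ρ : ℝ) (i : Fin d → ℤ) : Set (Euc d) :=
  {x | ∀ l, |x l - gridPoint ρ i l| ≤ ρ / 2}

/-- The one-dimensional hat function `max {1 - |s|, 0}`. -/
def hat (s : ℝ) : ℝ := max (1 - |s|) 0

/-- The `ℚ₁` nodal basis function `β_i` of the cubic lattice with vertices `x_i`: the function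
which is affine in each variable on each cell, is `1` at `x_i` and is `0` at the other vertices. -/
def basisFn {d : ℕ} (ρ : ℝ) (i : Fin d → ℤ) (x : Euc d) : ℝ :=
  ∏ l, hat ((x l - gridPoint ρ i l) / ρ)

/-- The measure `∑ i, w_i δ_{x_i}`. -/
def gridMeasure {d : ℕ} (ρ : ℝ) (w : (Fin d → ℤ) → ℝ) : Measure (Euc d) :=
  Measure.sum fun i => ENNReal.ofReal (w i) • Measure.dirac (gridPoint ρ i)

/-- Arrays `(μ_{i,k})` indexed by `k = 0, …, N` and `i ∈ ℤ^d`. -/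
abbrev GridArray (d N : ℕ) := Fin (N + 1) → (Fin d → ℤ) → ℝ

/-- Probability weights on the grid with finite first moment. -/
def IsGridProb {d : ℕ} (ρ : ℝ) (w : (Fin d → ℤ) → ℝ) : Prop :=
  (∀ i, 0 ≤ w i) ∧ HasSum w 1 ∧ Summable fun i => ‖gridPoint ρ i‖ * w i

/-- The set `S^{ρ,h}` of families of probability weights on the grid with finite first moment, one
for each time node `t_0, …, t_N`. -/
def gridWeights (d N : ℕ) (ρ : ℝ) : Set (GridArray d N) :=
  {μ | ∀ k, IsGridProb ρ (μ k)}

theorem lintegral_gridMeasure {d : ℕ} (ρ : ℝ) (w : (Fin d → ℤ) → ℝ) (f : Euc d → ℝ≥0∞)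
    (hf : Measurable f) :
    ∫⁻ x, f x ∂gridMeasure ρ w = ∑' i, ENNReal.ofReal (w i) * f (gridPoint ρ i) := by
  rw [gridMeasure, lintegral_sum_measure]
  refine tsum_congr fun i => ?_
  rw [lintegral_smul_measure, lintegral_dirac' _ hf, smul_eq_mul]

theorem tsum_moment_lt_top {d : ℕ} {ρ : ℝ} {w : (Fin d → ℤ) → ℝ} (hw : IsGridProb ρ w) :
    ∑' i, ENNReal.ofReal (w i) * ‖gridPoint ρ i‖ₑ < ∞ := by
  have h : ∀ i, ENNReal.ofReal (w i) * ‖gridPoint ρ i‖ₑ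
      = ENNReal.ofReal (‖gridPoint ρ i‖ * w i) := fun i => by
    rw [ENNReal.ofReal_mul (norm_nonneg _), ofReal_norm, mul_comm]
  simp_rw [h]
  exact hw.2.2.tsum_ofReal_lt_top

/-- Probability weights on the grid define a probability measure with finite first moment. -/
def IsGridProb.toP1 {d : ℕ} {ρ : ℝ} {w : (Fin d → ℤ) → ℝ} (hw : IsGridProb ρ w) : P1 d where
  meas := gridMeasure ρ w
  isProb := by
    constructor
    rw [← lintegral_one, lintegral_gridMeasure _ _ _ measurable_const]
    simp only [mul_one]
    rw [← ENNReal.ofReal_tsum_of_nonneg hw.1 hw.2.1.summable, hw.2.1.tsum_eq, ENNReal.ofReal_one]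
  moment := by
    rw [lintegral_gridMeasure _ _ _ (by fun_prop)]
    exact tsum_moment_lt_top hw

/-! ### Time grid and interpolation in time -/

/-- The time node `t_k = k h`, where `h = T / N`, as a point of `[0,T]`. -/
def timeNode (T : ℝ) (N : ℕ) (hT : 0 < T) (k : Fin (N + 1)) : Set.Icc (0 : ℝ) T :=
  ⟨(k : ℝ) * (T / N), by
    have hk : (k : ℝ) ≤ N := by exact_mod_cast Nat.lt_succ_iff.1 k.2
    refine ⟨by positivity, ?_⟩
    rcases Nat.eq_zero_or_pos N with h0 | h0
    · subst h0; simpa using hT.le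
    · have hN : (0 : ℝ) < N := by exact_mod_cast h0
      calc (k : ℝ) * (T / N) ≤ N * (T / N) := by gcongr
        _ = T := by field_simp⟩

/-- Weights at time `t` of the interpolation of `μ`, piecewise affine in time with nodes `t_k`. -/
def interpWeights {d N : ℕ} (T : ℝ) (μ : GridArray d N) (t : ℝ) (i : Fin d → ℤ) : ℝ :=
  ∑ k : Fin (N + 1), hat (t / (T / N) - (k : ℝ)) * μ k i

theorem hat_nonneg (s : ℝ) : 0 ≤ hat s := le_max_right _ _

theorem continuous_hat : Continuous hat := by unfold hat; fun_prop

theorem sum_hat_mul {N : ℕ} (k : Fin N) {s : ℝ} (h1 : (k : ℝ) ≤ s) (h2 : s ≤ k + 1)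
    (f : Fin (N + 1) → ℝ) :
    ∑ j : Fin (N + 1), hat (s - (j : ℝ)) * f j
      = (s - k) * f k.succ + (k + 1 - s) * f k.castSucc := by
  rw [Fintype.sum_eq_add k.succ k.castSucc (Fin.castSucc_lt_succ (i := k)).ne']
  · congr 2
    · have : s - ((k.succ : Fin (N + 1)) : ℝ) ≤ 0 := by simp; linarith
      rw [hat, abs_of_nonpos this, max_eq_left] <;> simp <;> linarith
    · have : 0 ≤ s - ((k.castSucc : Fin (N + 1)) : ℝ) := by simp; linarith
      rw [hat, abs_of_nonneg this, max_eq_left] <;> simp <;> linarith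
  · rintro j ⟨hj1, hj2⟩
    have hj1' : (j : ℕ) ≠ k + 1 := fun h => hj1 (Fin.ext (by simpa using h))
    have hj2' : (j : ℕ) ≠ k := fun h => hj2 (Fin.ext (by simpa using h))
    have : hat (s - (j : ℝ)) = 0 := by
      rw [hat, max_eq_right]
      rcases lt_or_gt_of_ne hj2' with h | h
      · have : (j : ℝ) + 1 ≤ k := by exact_mod_cast h
        have := le_abs_self (s - (j : ℝ))
        linarith
      · have : (k : ℝ) + 2 ≤ j := by
          have : (k : ℕ) + 2 ≤ j := by omega
          exact_mod_cast this
        have := neg_le_abs (s - (j : ℝ))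
        linarith
    rw [this, zero_mul]

theorem sum_hat {N : ℕ} (hN : 0 < N) {s : ℝ} (h0 : 0 ≤ s) (h1 : s ≤ N) :
    ∑ j : Fin (N + 1), hat (s - (j : ℝ)) = 1 := by
  obtain ⟨k, hk1, hk2⟩ : ∃ k : Fin N, (k : ℝ) ≤ s ∧ s ≤ k + 1 := by
    rcases lt_or_ge s N with h | h
    · exact ⟨⟨⌊s⌋₊, (Nat.floor_lt h0).2 h⟩, Nat.floor_le h0, (Nat.lt_floor_add_one s).le⟩
    · have hc : ((N - 1 : ℕ) : ℝ) + 1 = N := by exact_mod_cast Nat.sub_add_cancel hN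
      refine ⟨⟨N - 1, by omega⟩, ?_, ?_⟩ <;> simp only [] <;> linarith
  have := sum_hat_mul k hk1 hk2 fun _ => 1
  simp only [mul_one] at this
  rw [this]
  ring

theorem interpWeights_mem {d N : ℕ} {ρ T : ℝ} (hT : 0 < T) (hN : 0 < N) {μ : GridArray d N}
    (hμ : μ ∈ gridWeights d N ρ) {t : ℝ} (ht : t ∈ Set.Icc 0 T) :
    IsGridProb ρ (interpWeights T μ t) := by
  have hN' : (0 : ℝ) < N := by exact_mod_cast hN
  have hs : t / (T / N) ≤ N := by
    rw [div_le_iff₀ (by positivity)]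
    calc t ≤ T := ht.2
      _ = N * (T / N) := by field_simp
  refine ⟨fun i => Finset.sum_nonneg fun k _ => mul_nonneg (hat_nonneg _) ((hμ k).1 i), ?_, ?_⟩
  · have h := hasSum_sum (s := Finset.univ) fun (k : Fin (N + 1)) _ =>
      (hμ k).2.1.mul_left (hat (t / (T / N) - (k : ℝ)))
    simp only [mul_one] at h
    rwa [sum_hat hN (div_nonneg ht.1 (by positivity)) hs] at h
  · have h := summable_sum (s := Finset.univ) fun (k : Fin (N + 1)) _ =>
      (hμ k).2.2.mul_left (hat (t / (T / N) - (k : ℝ)))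
    refine h.congr fun i => ?_
    rw [interpWeights, Finset.mul_sum]
    exact Finset.sum_congr rfl fun k _ => by ring

theorem gridMeasure_add {d : ℕ} (ρ : ℝ) {v w : (Fin d → ℤ) → ℝ} (hv : ∀ i, 0 ≤ v i)
    (hw : ∀ i, 0 ≤ w i) :
    gridMeasure ρ (fun i => v i + w i) = gridMeasure ρ v + gridMeasure ρ w := by
  unfold gridMeasure
  rw [Measure.sum_add_sum]
  congr 1
  funext i
  rw [ENNReal.ofReal_add (hv i) (hw i), add_smul]

theorem gridMeasure_smul {d : ℕ} (ρ : ℝ) {a : ℝ} (ha : 0 ≤ a) (w : (Fin d → ℤ) → ℝ) :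
    gridMeasure ρ (fun i => a * w i) = ENNReal.ofReal a • gridMeasure ρ w := by
  ext s hs
  simp only [gridMeasure, Measure.smul_apply, Measure.sum_apply _ hs, smul_eq_mul,
    ENNReal.ofReal_mul ha, ← ENNReal.tsum_mul_left, mul_assoc]

/-- On `[t_k, t_{k+1}]` the interpolation is the measure
`((t - t_k) / h) ∑ μ_{i,k+1} δ_{x_i} + ((t_{k+1} - t) / h) ∑ μ_{i,k} δ_{x_i}`. -/
theorem gridMeasure_interpWeights {d N : ℕ} {ρ T : ℝ} (hT : 0 < T) {μ : GridArray d N}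
    (hμ : μ ∈ gridWeights d N ρ) (k : Fin N) {t : ℝ}
    (h1 : (timeNode T N hT k.castSucc : ℝ) ≤ t) (h2 : t ≤ timeNode T N hT k.succ) :
    gridMeasure ρ (interpWeights T μ t)
      = ENNReal.ofReal ((t - timeNode T N hT k.castSucc) / (T / N)) • gridMeasure ρ (μ k.succ)
        + ENNReal.ofReal ((timeNode T N hT k.succ - t) / (T / N))
          • gridMeasure ρ (μ k.castSucc) := by
  have hN : (0 : ℝ) < N := by exact_mod_cast k.pos
  have hh : 0 < T / N := by positivity
  have a1 : 0 ≤ (t - timeNode T N hT k.castSucc) / (T / N) := div_nonneg (by linarith) hh.le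
  have a2 : 0 ≤ (timeNode T N hT k.succ - t) / (T / N) := div_nonneg (by linarith) hh.le
  have e1 : (t - timeNode T N hT k.castSucc) / (T / N) = t / (T / N) - k := by
    simp only [timeNode, Fin.val_castSucc]; field_simp
  have e2 : (timeNode T N hT k.succ - t) / (T / N) = k + 1 - t / (T / N) := by
    simp only [timeNode, Fin.val_succ]; push_cast; field_simp
  rw [← gridMeasure_smul ρ a1, ← gridMeasure_smul ρ a2,
    ← gridMeasure_add ρ (fun i => mul_nonneg a1 ((hμ _).1 i))
      (fun i => mul_nonneg a2 ((hμ _).1 i))]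
  congr 1
  funext i
  rw [e1] at a1
  rw [e2] at a2
  rw [e1, e2, interpWeights]
  exact sum_hat_mul k (by linarith) (by linarith) fun j => μ j i

theorem dist1_gridMeasure_le {d : ℕ} {ρ : ℝ} {v w : (Fin d → ℤ) → ℝ} (hv : IsGridProb ρ v)
    (hw : IsGridProb ρ w) :
    dist1 (gridMeasure ρ v) (gridMeasure ρ w)
      ≤ 2 * ∑' i, ENNReal.ofReal |v i - w i| * ‖gridPoint ρ i‖ₑ := by
  have split : ∀ {a b : (Fin d → ℤ) → ℝ}, IsGridProb ρ a → IsGridProb ρ b →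
      gridMeasure ρ a = gridMeasure ρ (fun i => min (a i) (b i))
        + gridMeasure ρ (fun i => max (a i - b i) 0) := by
    intro a b ha hb
    rw [← gridMeasure_add ρ (fun i => le_min (ha.1 i) (hb.1 i)) (fun i => le_max_right _ _)]
    congr 1
    funext i
    rcases le_total (a i) (b i) with h | h
    · rw [min_eq_left h, max_eq_right (by linarith), add_zero]
    · rw [min_eq_right h, max_eq_left (by linarith)]; ring
  have hw' := split hw hv
  simp_rw [min_comm (w _) (v _)] at hw'
  have bound : ∀ {a b : (Fin d → ℤ) → ℝ},
      ∫⁻ x, ‖x‖ₑ ∂gridMeasure ρ (fun i => max (a i - b i) 0)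
        ≤ ∑' i, ENNReal.ofReal |a i - b i| * ‖gridPoint ρ i‖ₑ := by
    intro a b
    rw [lintegral_gridMeasure _ _ _ (by fun_prop)]
    refine ENNReal.tsum_le_tsum fun i => ?_
    gcongr
    exact max_le (le_abs_self _) (abs_nonneg _)
  have : IsProbabilityMeasure (gridMeasure ρ v) := hv.toP1.isProb
  have : IsProbabilityMeasure (gridMeasure ρ w) := hw.toP1.isProb
  refine (dist1_le_of_add (split hv hw) hw').trans ?_
  rw [two_mul]
  refine add_le_add bound (bound.trans (le_of_eq ?_))
  simp_rw [abs_sub_comm]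

theorem continuous_interp {d N : ℕ} {ρ T : ℝ} (hT : 0 < T) (hN : 0 < N) {μ : GridArray d N}
    (hμ : μ ∈ gridWeights d N ρ) :
    Continuous fun t : Set.Icc (0 : ℝ) T => (interpWeights_mem hT hN hμ t.2).toP1 := by
  rw [continuous_iff_continuousAt]
  intro t
  rw [ContinuousAt, tendsto_iff_edist_tendsto_0]
  have hbound : ∀ s : Set.Icc (0 : ℝ) T,
      edist (interpWeights_mem hT hN hμ s.2).toP1 (interpWeights_mem hT hN hμ t.2).toP1
        ≤ 2 * ∑ k : Fin (N + 1),
          ENNReal.ofReal |hat ((s : ℝ) / (T / N) - (k : ℝ)) - hat ((t : ℝ) / (T / N) - (k : ℝ))|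
            * ∑' i, ENNReal.ofReal (μ k i) * ‖gridPoint ρ i‖ₑ := by
    intro s
    refine (dist1_gridMeasure_le (interpWeights_mem hT hN hμ s.2)
      (interpWeights_mem hT hN hμ t.2)).trans ?_
    gcongr
    simp_rw [← ENNReal.tsum_mul_left]
    rw [← Summable.tsum_finsetSum fun _ _ => ENNReal.summable]
    refine ENNReal.tsum_le_tsum fun i => ?_
    simp_rw [← mul_assoc]
    rw [← Finset.sum_mul]
    gcongr
    simp_rw [← ENNReal.ofReal_mul (abs_nonneg _)]
    rw [← ENNReal.ofReal_sum_of_nonneg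
      fun k _ => mul_nonneg (abs_nonneg _) ((hμ k).1 i)]
    refine ENNReal.ofReal_le_ofReal ?_
    rw [interpWeights, interpWeights, ← Finset.sum_sub_distrib]
    refine (Finset.abs_sum_le_sum_abs _ _).trans (Finset.sum_le_sum fun k _ => ?_)
    rw [← sub_mul, abs_mul, abs_of_nonneg ((hμ k).1 i)]
  refine tendsto_of_tendsto_of_tendsto_of_le_of_le tendsto_const_nhds ?_
    (fun _ => zero_le) hbound
  have hlim : Tendsto (fun s : Set.Icc (0 : ℝ) T => 2 * ∑ k : Fin (N + 1),
          ENNReal.ofReal |hat ((s : ℝ) / (T / N) - (k : ℝ)) - hat ((t : ℝ) / (T / N) - (k : ℝ))|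
            * ∑' i, ENNReal.ofReal (μ k i) * ‖gridPoint ρ i‖ₑ) (𝓝 t)
      (𝓝 (2 * ∑ k : Fin (N + 1),
          0 * ∑' i, ENNReal.ofReal (μ k i) * ‖gridPoint ρ i‖ₑ)) := by
    refine ENNReal.Tendsto.const_mul (tendsto_finsetSum _ fun k _ => ?_)
      (Or.inr ENNReal.ofNat_ne_top)
    refine ENNReal.Tendsto.mul_const ?_ (Or.inr (tsum_moment_lt_top (hμ k)).ne)
    have hc : Continuous fun s : Set.Icc (0 : ℝ) T => ENNReal.ofReal
        |hat ((s : ℝ) / (T / N) - (k : ℝ)) - hat ((t : ℝ) / (T / N) - (k : ℝ))| := by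
      refine ENNReal.continuous_ofReal.comp ?_
      have := continuous_hat
      fun_prop
    simpa using hc.tendsto t
  simpa using hlim

/-- The curve in `C([0,T]; P1)` obtained from `μ ∈ S^{ρ,h}` by interpolation in time. -/
def interp {d N : ℕ} {ρ T : ℝ} (hT : 0 < T) (hN : 0 < N) (μ : gridWeights d N ρ) :
    Curves d T where
  toFun t := (interpWeights_mem hT hN μ.2 t.2).toP1
  continuous_toFun := continuous_interp hT hN μ.2

/-! ### The coefficients and the scheme -/

/-- The Frobenius norm of a matrix. -/
def frob {d r : ℕ} (A : Matrix (Fin d) (Fin r) ℝ) : ℝ := Real.sqrt (∑ i, ∑ j, A i j ^ 2)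

/-- The assumption on the coefficients: (i) `b` and `σ` are continuous in `(μ, x, t)`;
(ii) they have linear growth in `x`, uniformly in `μ` and `t`. -/
structure AssumptionH {d r : ℕ} {T : ℝ} (b : Curves d T × Euc d × Set.Icc (0 : ℝ) T → Euc d)
    (σ : Curves d T × Euc d × Set.Icc (0 : ℝ) T → Matrix (Fin d) (Fin r) ℝ) : Prop where
  continuous_b : Continuous b
  continuous_σ : Continuous σ
  linear_growth : ∃ C > 0, ∀ μ x t, ‖b (μ, x, t)‖ + frob (σ (μ, x, t)) ≤ C * (1 + ‖x‖)

/-- The `ℓ`-th column of a matrix, as a vector. -/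
def column {d r : ℕ} (A : Matrix (Fin d) (Fin r) ℝ) (l : Fin r) : Euc d :=
  WithLp.toLp 2 fun i => A i l

/-- The discrete characteristic
`Φ_{j,k}^{ℓ,±}[μ] = x_j + h b[μ](x_j,t_k) ± √(r h) σ_ℓ[μ](x_j,t_k)`, where `ε = ±1` is the sign
and `h = T / N`. -/
def Phi {d r N : ℕ} {T : ℝ} (hT : 0 < T) (ρ : ℝ)
    (b : Curves d T × Euc d × Set.Icc (0 : ℝ) T → Euc d)
    (σ : Curves d T × Euc d × Set.Icc (0 : ℝ) T → Matrix (Fin d) (Fin r) ℝ)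
    (μ : Curves d T) (ε : ℝ) (j : Fin d → ℤ) (k : Fin (N + 1)) (l : Fin r) : Euc d :=
  gridPoint ρ j + (T / N) • b (μ, gridPoint ρ j, timeNode T N hT k)
    + (ε * Real.sqrt (r * (T / N))) • column (σ (μ, gridPoint ρ j, timeNode T N hT k)) l

/-- The map `F^{ρ,h}`: the array `m[μ]` with `m_{i,0} = m₀(E_i)` and
`m_{i,k+1} = 1/(2r) ∑_ℓ ∑_j [β_i(Φ_{j,k}^{ℓ,+}[μ]) + β_i(Φ_{j,k}^{ℓ,-}[μ])] m_{j,k}`,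
in which the coefficients are evaluated along the interpolation of `μ`. -/
def schemeMap {d r N : ℕ} {T ρ : ℝ} (hT : 0 < T) (hN : 0 < N) (m₀ : Measure (Euc d))
    (b : Curves d T × Euc d × Set.Icc (0 : ℝ) T → Euc d)
    (σ : Curves d T × Euc d × Set.Icc (0 : ℝ) T → Matrix (Fin d) (Fin r) ℝ)
    (μ : gridWeights d N ρ) : GridArray d N :=
  Fin.induction (motive := fun _ => (Fin d → ℤ) → ℝ)
    (fun i => m₀.real (cube ρ i))
    (fun k m i => 1 / (2 * (r : ℝ)) * ∑ l : Fin r, ∑' j : Fin d → ℤ,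
      (basisFn ρ i (Phi hT ρ b σ (interp hT hN μ) 1 j k.castSucc l)
        + basisFn ρ i (Phi hT ρ b σ (interp hT hN μ) (-1) j k.castSucc l)) * m j)

end FPK

end

/-! The basis functions are nonnegative and sum to one, so each step of the scheme applies a Markov
kernel on the grid. By linear growth of the coefficients, one step from `x_j` produces a second
moment at most `A (1 + |x_j|²)`, with `A` independent of the curve. Induction over the finitely many
time levels bounds the second moments of the image of every array by one constant `M`
(`exists_hasMomentLE_schemeMap`). Finite second moments imply finite first moments, which gives the
invariance claim.

The bound on second moments is also the source of compactness. If arrays converge entrywise with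
bounded second moments, no mass or first moment escapes (`tendsto_tsum_of_moment_le`), so the
interpolated curves converge uniformly in `d₁` (`tendsto_interp`) and the scheme converges entrywise
(`tendsto_schemeMap`). Instead of Schauder's theorem, the scheme is truncated to a finite set `B` of
grid points, the lost mass being moved to the origin. Brouwer's theorem gives a fixed point for each
`B`. Truncating probability weights does not increase their second moment, so all these fixed points
obey the bound `M`, and their limit along an ultrafilter on the sets `B` is a fixed point of the
full scheme.

Brouwer's theorem is derived from the absence of a `C¹` map onto the sphere that fixes it. For `g`
vanishing on the sphere, the integral of `det (1 + t Dg)` over the ball is polynomial in `t` and,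
for small `t`, equal to the volume, hence equal to it at `t = 1` as well. For `g = r - id` with
`|r|` constant, the determinant at `t = 1` vanishes identically. -/

noncomputable section

/-! ### Brouwer's fixed point theorem by integrating a Jacobian -/

namespace Brouwer

open Polynomial in
/-- The characteristic-type determinant `det (1 + t A)` is a polynomial in `t` of degree at most
the dimension. -/
theorem exists_polynomial_det {E : Type*} [AddCommGroup E] [Module ℝ E] [FiniteDimensional ℝ E]
    (A : E →ₗ[ℝ] E) : ∃ p : ℝ[X], p.natDegree ≤ Module.finrank ℝ E ∧
      ∀ t, p.eval t = LinearMap.det (LinearMap.id + t • A) := by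
  classical
  let β := Module.finBasis ℝ E
  let M := LinearMap.toMatrix β β A
  refine ⟨Matrix.det ((X : ℝ[X]) • M.map C + (1 : Matrix _ _ ℝ).map C), ?_, fun t => ?_⟩
  · simpa using natDegree_det_X_add_C_le M 1
  · rw [← LinearMap.det_toMatrix β, ← coe_evalRingHom, RingHom.map_det]
    congr 1
    ext i j
    by_cases hij : i = j
    · subst hij
      simp [M, add_comm, mul_comm t]
    · simp [M, hij, mul_comm t]

/-- A polynomial of degree at most `n` is determined by its values at `n + 1` nodes. This form
carries an integral identity from small nodes to `t = 1` without integrating coefficients. -/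
theorem det_eq_sum_lagrange {E : Type*} [AddCommGroup E] [Module ℝ E] [FiniteDimensional ℝ E]
    {v : ℕ → ℝ} (hv : Function.Injective v) (A : E →ₗ[ℝ] E) (t : ℝ) :
    LinearMap.det (LinearMap.id + t • A)
      = ∑ k ∈ Finset.range (Module.finrank ℝ E + 1),
        LinearMap.det (LinearMap.id + v k • A)
          * (Lagrange.basis (Finset.range (Module.finrank ℝ E + 1)) v k).eval t := by
  obtain ⟨p, hp, hdet⟩ := exists_polynomial_det A
  have hdeg : p.degree < (Finset.range (Module.finrank ℝ E + 1)).card := by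
    rw [Finset.card_range]
    exact lt_of_le_of_lt (Polynomial.natDegree_le_iff_degree_le.1 hp) (by exact_mod_cast Nat.lt_succ_self _)
  have h := Lagrange.eq_interpolate (s := Finset.range (Module.finrank ℝ E + 1)) hv.injOn hdeg
  rw [← hdet]
  conv_lhs => rw [h]
  rw [Lagrange.interpolate_apply, Polynomial.eval_finsetSum]
  refine Finset.sum_congr rfl fun k _ => ?_
  rw [Polynomial.eval_mul, Polynomial.eval_C, hdet]

/-- A Lipschitz map of a ball that vanishes on the sphere stays Lipschitz when extended by zero. -/
theorem lipschitzWith_indicator {E F : Type*} [NormedAddCommGroup E] [NormedSpace ℝ E]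
    [NormedAddCommGroup F] {R : ℝ} {K : NNReal} {g : E → F}
    (hg : LipschitzOnWith K g (Metric.closedBall 0 R))
    (h0 : ∀ x, ‖x‖ = R → g x = 0) :
    LipschitzWith K ((Metric.closedBall (0 : E) R).indicator g) := by
  -- The segment from `x` to `y` meets the sphere at some `z`, where `g` vanishes and which is no
  -- farther from `x` than `y` is.
  have key : ∀ x y, x ∈ Metric.closedBall (0 : E) R → y ∉ Metric.closedBall (0 : E) R →
      ‖g x‖ ≤ K * dist x y := by
    intro x y hx hy
    rw [mem_closedBall_zero_iff] at hy
    obtain ⟨z, hz, hz'⟩ := (convex_segment (𝕜 := ℝ) x y).isPreconnected.intermediate_value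
      (left_mem_segment ℝ x y) (right_mem_segment ℝ x y) continuous_norm.continuousOn
      (show R ∈ Set.Icc ‖x‖ ‖y‖ from ⟨by simpa using hx, (not_le.1 hy).le⟩)
    have h1 := hg.dist_le_mul x hx z (by simp [hz'])
    rw [h0 z hz', dist_zero_right] at h1
    refine h1.trans ?_
    gcongr
    have := dist_add_dist_of_mem_segment hz
    linarith [dist_nonneg (x := z) (y := y)]
  refine LipschitzWith.of_dist_le_mul fun x y => ?_
  by_cases hx : x ∈ Metric.closedBall (0 : E) R <;> by_cases hy : y ∈ Metric.closedBall (0 : E) R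
  · rw [Set.indicator_of_mem hx, Set.indicator_of_mem hy]
    exact hg.dist_le_mul x hx y hy
  · rw [Set.indicator_of_mem hx, Set.indicator_of_notMem hy, dist_zero_right]
    exact key x y hx hy
  · rw [Set.indicator_of_notMem hx, Set.indicator_of_mem hy, dist_zero_left, dist_comm]
    exact key y x hy hx
  · rw [Set.indicator_of_notMem hx, Set.indicator_of_notMem hy, dist_self]
    positivity

/-- A small Lipschitz perturbation of the identity that vanishes on the sphere is a bijection of
the ball. -/
theorem bijOn_closedBall {E : Type*} [NormedAddCommGroup E] [NormedSpace ℝ E] [CompleteSpace E]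
    {R : ℝ} {K : NNReal} (hK : K < 1) {g : E → E}
    (hg : LipschitzOnWith K g (Metric.closedBall 0 R)) (h0 : ∀ x, ‖x‖ = R → g x = 0) :
    Set.BijOn (fun x => x + g x) (Metric.closedBall 0 R) (Metric.closedBall 0 R) := by
  set B := Metric.closedBall (0 : E) R
  set G := B.indicator g with hG
  have hL : LipschitzWith K G := lipschitzWith_indicator hg h0
  -- Solutions of `x + G x = y` are the fixed points of this contraction, so `id + G` is a bijection
  -- of the whole space.
  have hc : ∀ y, ContractingWith K fun x => y - G x := fun y => by
    refine ⟨hK, LipschitzWith.of_dist_le_mul fun a b => ?_⟩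
    rw [dist_sub_left]
    exact hL.dist_le_mul a b
  have hinj : ∀ x x', x + G x = x' + G x' → x = x' := fun x x' h =>
    (hc (x + G x)).fixedPoint_unique' (by simp [Function.IsFixedPt]) (by simp [Function.IsFixedPt, h])
  have hin : ∀ x ∈ B, x + g x = x + G x := fun x hx => by rw [hG, Set.indicator_of_mem hx]
  have hout : ∀ x, x ∉ B → x + G x = x := fun x hx => by
    rw [hG, Set.indicator_of_notMem hx, add_zero]
  refine ⟨fun x hx => ?_, fun x hx x' hx' h => ?_, fun y hy => ?_⟩
  -- A point outside the ball is its own image under `id + G`, so injectivity forbids a point of the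
  -- ball from being sent to it.
  · by_contra hy
    have h1 := hinj x (x + g x) ((hin x hx).symm.trans (hout _ hy).symm)
    exact hy (by simpa only [← h1] using hx)
  · simp only [hin x hx, hin x' hx'] at h
    exact hinj x x' h
  · have hfix := (hc y).fixedPoint_isFixedPt
    set x := (hc y).fixedPoint
    have hx : x + G x = y := (sub_eq_iff_eq_add.1 (show y - G x = x from hfix)).symm
    have hxB : x ∈ B := by
      by_contra hxB
      rw [hout x hxB] at hx
      exact hxB (hx ▸ hy)
    exact ⟨x, hxB, by simp only [hin x hxB, hx]⟩

variable {E : Type*} [NormedAddCommGroup E] [InnerProductSpace ℝ E] [FiniteDimensional ℝ E]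

/-- The determinant is continuous and equals one at the identity. Positivity removes the absolute
value in the change of variables formula. -/
theorem exists_det_pos (E : Type*) [NormedAddCommGroup E] [InnerProductSpace ℝ E]
    [FiniteDimensional ℝ E] : ∃ δ > 0, ∀ A : E →L[ℝ] E, ‖A‖ < δ →
      0 < (ContinuousLinearMap.id ℝ E + A).det := by
  have hc : Continuous fun A : E →L[ℝ] E => (ContinuousLinearMap.id ℝ E + A).det :=
    ContinuousLinearMap.continuous_det.comp (by fun_prop)
  have h0 : (0 : ℝ) < (ContinuousLinearMap.id ℝ E + 0).det := by
    simp [ContinuousLinearMap.det]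
  obtain ⟨δ, hδ, h⟩ := Metric.eventually_nhds_iff.1
    (hc.continuousAt.eventually (lt_mem_nhds h0))
  exact ⟨δ, hδ, fun A hA => h (by simpa using hA)⟩

/-- The integral of the Jacobian of `id + t g` over a ball does not depend on small `t` if `g`
vanishes on the sphere. -/
theorem exists_integral_det_eq [MeasurableSpace E] [BorelSpace E] {R : ℝ} {g : E → E}
    (hg : ContDiff ℝ 1 g) (h0 : ∀ x, ‖x‖ = R → g x = 0) : ∃ τ > 0, ∀ t : ℝ, 0 ≤ t → t < τ →
      ∫ x in Metric.closedBall (0 : E) R, (ContinuousLinearMap.id ℝ E + t • fderiv ℝ g x).det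
        = volume.real (Metric.closedBall (0 : E) R) := by
  obtain ⟨δ, hδ, hdet⟩ := exists_det_pos E
  have hcd : Continuous (fderiv ℝ g) := hg.continuous_fderiv one_ne_zero
  obtain ⟨K, hK⟩ := (isCompact_closedBall (0 : E) R).exists_bound_of_continuousOn hcd.continuousOn
  have hK0 : (0 : ℝ) < max K 1 := lt_of_lt_of_le one_pos (le_max_right _ _)
  -- The `1` makes `t g` a contraction on the ball; the `δ` keeps the Jacobian positive.
  refine ⟨min 1 δ / max K 1, by positivity, fun t ht htτ => ?_⟩
  rw [lt_div_iff₀ hK0] at htτ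
  have hbound : ∀ x ∈ Metric.closedBall (0 : E) R, ‖t • fderiv ℝ g x‖ ≤ t * max K 1 :=
    fun x hx => by
      rw [norm_smul, Real.norm_of_nonneg ht]
      gcongr
      exact (hK x hx).trans (le_max_left _ _)
  have hd : ∀ x, HasFDerivAt (fun x => t • g x) (t • fderiv ℝ g x) x := fun x =>
    ((hg.differentiable one_ne_zero x).hasFDerivAt).const_smul t
  have hlip : LipschitzOnWith (Real.toNNReal (t * max K 1)) (fun x => t • g x)
      (Metric.closedBall (0 : E) R) :=
    (convex_closedBall (0 : E) R).lipschitzOnWith_of_nnnorm_hasFDerivWithin_le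
      (fun x _ => (hd x).hasFDerivWithinAt) fun x hx => by
        rw [← NNReal.coe_le_coe, Real.coe_toNNReal _ (by positivity)]
        exact hbound x hx
  have hbij := bijOn_closedBall (by
    rw [Real.toNNReal_lt_one]
    exact htτ.trans_le (min_le_left _ _)) hlip (fun x hx => by simp [h0 x hx])
  have hvol := lintegral_abs_det_fderiv_eq_addHaar_image volume
    (Metric.isClosed_closedBall (x := (0 : E)) (ε := R)).measurableSet
    (fun x _ => ((hasFDerivAt_id x).add (hd x)).hasFDerivWithinAt) hbij.injOn
  have himg := hbij.image_eq
  have hpos : ∀ x ∈ Metric.closedBall (0 : E) R,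
      0 < (ContinuousLinearMap.id ℝ E + t • fderiv ℝ g x).det := fun x hx =>
    hdet _ ((hbound x hx).trans_lt (htτ.trans_le (min_le_right _ _)))
  rw [integral_eq_lintegral_of_nonneg_ae, measureReal_def]
  · congr 1
    conv_rhs => rw [← himg]
    refine Eq.trans ?_ hvol
    refine setLIntegral_congr_fun (Metric.isClosed_closedBall).measurableSet fun x hx => ?_
    rw [abs_of_pos (hpos x hx)]
  · filter_upwards [ae_restrict_mem (Metric.isClosed_closedBall).measurableSet] with x hx
    exact (hpos x hx).le
  · exact (ContinuousLinearMap.continuous_det.comp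
      (continuous_const.add (hcd.const_smul t))).aestronglyMeasurable

theorem integral_det_eq [MeasurableSpace E] [BorelSpace E] {R : ℝ} {g : E → E}
    (hg : ContDiff ℝ 1 g) (h0 : ∀ x, ‖x‖ = R → g x = 0) :
      ∫ x in Metric.closedBall (0 : E) R, (ContinuousLinearMap.id ℝ E + fderiv ℝ g x).det
        = volume.real (Metric.closedBall (0 : E) R) := by
  obtain ⟨τ, hτ, h⟩ := exists_integral_det_eq hg h0
  have hcd : Continuous (fderiv ℝ g) := hg.continuous_fderiv one_ne_zero
  -- Distinct interpolation nodes in `(0, τ)`; the offset `2` makes even the node for `k = 0`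
  -- strictly less than `τ`.
  set v : ℕ → ℝ := fun k => τ / (k + 2) with hv
  have hvinj : Function.Injective v := fun a b hab => by
    have : (a : ℝ) + 2 = b + 2 := by
      simpa [hv, div_eq_mul_inv, hτ.ne'] using hab
    exact_mod_cast add_right_cancel this
  have hvint : ∀ k, ∫ x in Metric.closedBall (0 : E) R,
      (ContinuousLinearMap.id ℝ E + v k • fderiv ℝ g x).det
        = volume.real (Metric.closedBall (0 : E) R) := fun k =>
    h _ (by positivity) (by
      simp only [hv]
      rw [div_lt_iff₀ (by positivity)]
      nlinarith [(Nat.cast_nonneg k : (0 : ℝ) ≤ k)])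
  have hdet : ∀ x, (ContinuousLinearMap.id ℝ E + fderiv ℝ g x).det
      = ∑ k ∈ Finset.range (Module.finrank ℝ E + 1),
        (ContinuousLinearMap.id ℝ E + v k • fderiv ℝ g x).det
          * (Lagrange.basis (Finset.range (Module.finrank ℝ E + 1)) v k).eval 1 := fun x => by
    have := det_eq_sum_lagrange hvinj (fderiv ℝ g x : E →ₗ[ℝ] E) 1
    rw [one_smul] at this
    exact this
  simp_rw [hdet]
  rw [integral_finsetSum]
  · simp_rw [integral_mul_const, hvint]
    rw [← Finset.mul_sum, ← Polynomial.eval_finsetSum, Lagrange.sum_basis hvinj.injOn (by simp),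
      Polynomial.eval_one, mul_one]
  · intro k _
    refine Integrable.mul_const ?_ _
    exact (ContinuousLinearMap.continuous_det.comp
      (continuous_const.add (hcd.const_smul (v k)))).continuousOn.integrableOn_compact
        (isCompact_closedBall _ _)

/-- There is no `C¹` map to a sphere that fixes the sphere. -/
theorem no_retraction [Nontrivial E] {R : ℝ} (hR : 0 < R) {r : E → E} (hr : ContDiff ℝ 1 r)
    (hnorm : ∀ x, ‖r x‖ = R) (hfix : ∀ x, ‖x‖ = R → r x = x) : False := by
  let _ : MeasurableSpace E := borel E
  have : BorelSpace E := ⟨rfl⟩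
  have h := integral_det_eq (R := R) (hr.sub contDiff_id) (g := fun x => r x - x)
    (fun x hx => by simp [hfix x hx])
  have hfd : ∀ x, ContinuousLinearMap.id ℝ E + fderiv ℝ (fun x => r x - x) x = fderiv ℝ r x :=
    fun x => by
      rw [fderiv_fun_sub (hr.differentiable one_ne_zero x) differentiableAt_fun_id]
      simp
  -- An invertible derivative would hit `r x` at some `y`; differentiating the constant `|r|²` in
  -- the direction `y` would then give `2 R² = 0`.
  have hz : ∀ x, (fderiv ℝ r x).det = 0 := fun x => by
    by_contra hne
    have hsurj : Function.Surjective (fderiv ℝ r x) := by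
      have := LinearMap.range_eq_top.1 ((LinearMap.isUnit_iff_range_eq_top _).1
        ((LinearMap.isUnit_iff_isUnit_det (fderiv ℝ r x : E →ₗ[ℝ] E)).2 (isUnit_iff_ne_zero.2 hne)))
      exact this
    obtain ⟨y, hy⟩ := hsurj (r x)
    have hd := (hr.differentiable one_ne_zero x).hasFDerivAt
    have h1 := hd.norm_sq
    have h2 : HasFDerivAt (fun x => ‖r x‖ ^ 2) (0 : E →L[ℝ] ℝ) x := by
      simp_rw [hnorm]
      exact hasFDerivAt_const _ _
    have h3 := congrArg (fun L : E →L[ℝ] ℝ => L y) (h1.unique h2)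
    simp [hy, hnorm x, hR.ne'] at h3
  simp_rw [hfd, hz, integral_zero] at h
  have hpos := Metric.measure_closedBall_pos (volume : Measure E) (0 : E) hR
  rw [measureReal_def, eq_comm, ENNReal.toReal_eq_zero_iff] at h
  rcases h with h | h
  · exact hpos.ne' h
  · exact (isCompact_closedBall (0 : E) R).measure_lt_top.ne h

/-- **Brouwer's fixed point theorem**, for a continuous map with values in the unit ball. -/
theorem exists_fixedPoint_of_norm_le_one {f : E → E} (hf : Continuous f) (hb : ∀ x, ‖f x‖ ≤ 1) :
    ∃ x, f x = x := by
  rcases subsingleton_or_nontrivial E with hE | hE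
  · exact ⟨0, Subsingleton.elim _ _⟩
  by_contra! hne
  -- A `C¹` approximation of `f` within `min (|f x - x|) 1`: the first bound keeps `p` free of fixed
  -- points, the second keeps `|p| < 2`.
  obtain ⟨p, hp⟩ := exists_contMDiffMap_forall_mem_convex_of_local_const (n := 1)
    (modelWithCornersSelf ℝ E) (t := fun x => Metric.ball (f x) (min (dist (f x) x) 1))
    (fun x => convex_ball _ _) (fun x => by
      refine ⟨f x, ?_⟩
      have hc : Continuous fun y => min (dist (f y) y) 1 - dist (f x) (f y) := by fun_prop
      have h0 : 0 < min (dist (f x) x) 1 - dist (f x) (f x) := by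
        simpa using hne x
      filter_upwards [hc.continuousAt.eventually (lt_mem_nhds h0)] with y hy
      rw [Metric.mem_ball]
      linarith)
  have hpc : ContDiff ℝ 1 p := p.contMDiff.contDiff
  have hpne : ∀ x, p x ≠ x := fun x h => by
    have := (Metric.mem_ball.1 (hp x)).trans_le (min_le_left _ _)
    rw [h, dist_comm] at this
    exact lt_irrefl _ this
  have hp2 : ∀ x, ‖p x‖ < 2 := fun x => by
    have h1 := (Metric.mem_ball.1 (hp x)).trans_le (min_le_right _ _)
    rw [dist_eq_norm] at h1
    have h2 := norm_add_le (p x - f x) (f x)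
    rw [sub_add_cancel] at h2
    linarith [hb x]
  -- The field `x - s x • p x` is `x - p x` for `|x| ≤ 2` and cannot vanish beyond, since there `|p
  -- x| < 2 < |x|`. On the sphere of radius `3` it is `x`, so normalising it to length `3` gives the
  -- forbidden retraction.
  let s : ContDiffBump (0 : E) := ⟨2, 3, by norm_num, by norm_num⟩
  have hsc : ContDiff ℝ 1 s := s.contDiff
  have hv : ∀ x, x - s x • p x ≠ 0 := fun x => by
    rcases le_or_gt ‖x‖ 2 with hx | hx
    · rw [s.one_of_mem_closedBall (by simpa [s] using hx), one_smul, sub_ne_zero]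
      exact (hpne x).symm
    · intro h
      have h1 : ‖x‖ ≤ ‖p x‖ := by
        calc ‖x‖ = ‖s x • p x‖ := congrArg _ (sub_eq_zero.1 h)
          _ = s x * ‖p x‖ := by rw [norm_smul, Real.norm_of_nonneg s.nonneg]
          _ ≤ 1 * ‖p x‖ := by gcongr; exact s.le_one
          _ = ‖p x‖ := one_mul _
      linarith [hp2 x]
  have hvc : ContDiff ℝ 1 fun x => x - s x • p x := contDiff_id.sub (hsc.smul hpc)
  refine no_retraction (R := 3) (by norm_num)
    (r := fun x => (3 * ‖x - s x • p x‖⁻¹) • (x - s x • p x)) ?_ (fun x => ?_) (fun x hx => ?_)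
  · exact (contDiff_const.mul ((hvc.norm ℝ hv).inv fun x => norm_ne_zero_iff.2 (hv x))).smul hvc
  · have := norm_ne_zero_iff.2 (hv x)
    rw [norm_smul, norm_mul, norm_inv, norm_norm, mul_assoc, inv_mul_cancel₀ this]
    norm_num
  · have : s x = 0 := s.zero_of_le_dist (by simp [s, hx])
    simp [this, hx]

/-- A continuous self-map of a Euclidean space with bounded range has a fixed point. -/
theorem exists_fixedPoint_of_bounded {f : E → E} (hf : Continuous f) {M : ℝ}
    (hb : ∀ x, ‖f x‖ ≤ M) : ∃ x, f x = x := by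
  have hM : (0 : ℝ) < max M 1 := lt_of_lt_of_le one_pos (le_max_right _ _)
  obtain ⟨x, hx⟩ := exists_fixedPoint_of_norm_le_one (f := fun x => (max M 1)⁻¹ • f (max M 1 • x))
    (by fun_prop) (fun x => by
      rw [norm_smul, norm_inv, Real.norm_of_nonneg hM.le, inv_mul_le_iff₀ hM, mul_one]
      exact (hb _).trans (le_max_left _ _))
  refine ⟨max M 1 • x, ?_⟩
  conv_rhs => rw [← hx]
  rw [smul_inv_smul₀ hM.ne']

end Brouwer

end

noncomputable section

namespace FPK

/-! ### The nodal basis -/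

theorem hat_eq_zero {s : ℝ} (h : 1 ≤ |s|) : hat s = 0 := max_eq_right (by linarith)

theorem hat_le_one (s : ℝ) : hat s ≤ 1 := max_le (by linarith [abs_nonneg s]) zero_le_one

theorem hat_sub_floor_add (s : ℝ) : hat (s - ⌊s⌋) + hat (s - (⌊s⌋ + 1)) = 1 := by
  have h1 := Int.floor_le s
  have h2 := Int.lt_floor_add_one s
  rw [hat, hat, abs_of_nonneg (by linarith), abs_of_nonpos (by linarith), max_eq_left (by linarith),
    max_eq_left (by linarith)]
  ring

theorem hat_sub_int_eq_zero {s : ℝ} {n : ℤ} (h1 : n ≠ ⌊s⌋) (h2 : n ≠ ⌊s⌋ + 1) :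
    hat (s - n) = 0 := by
  have h3 := Int.floor_le s
  have h4 := Int.lt_floor_add_one s
  refine hat_eq_zero ?_
  rcases lt_or_gt_of_ne h1 with h | h
  · have : (n : ℝ) + 1 ≤ ⌊s⌋ := by exact_mod_cast h
    exact le_abs.2 (Or.inl (by linarith))
  · have : (⌊s⌋ : ℝ) + 2 ≤ n := by
      have : ⌊s⌋ + 2 ≤ n := by omega
      exact_mod_cast this
    exact le_abs.2 (Or.inr (by linarith))

theorem basisFn_nonneg {d : ℕ} (ρ : ℝ) (i : Fin d → ℤ) (x : Euc d) : 0 ≤ basisFn ρ i x :=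
  Finset.prod_nonneg fun _ _ => hat_nonneg _

theorem basisFn_le_one {d : ℕ} (ρ : ℝ) (i : Fin d → ℤ) (x : Euc d) : basisFn ρ i x ≤ 1 :=
  Finset.prod_le_one (fun _ _ => hat_nonneg _) fun _ _ => hat_le_one _

theorem continuous_basisFn {d : ℕ} (ρ : ℝ) (i : Fin d → ℤ) : Continuous (basisFn ρ i) := by
  have := continuous_hat
  unfold basisFn
  fun_prop

/-- The nodal basis is a partition of unity. -/
theorem hasSum_basisFn {d : ℕ} {ρ : ℝ} (hρ : 0 < ρ) (x : Euc d) :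
    HasSum (fun i => basisFn ρ i x) 1 := by
  classical
  have harg : ∀ (i : Fin d → ℤ) l, (x l - gridPoint ρ i l) / ρ = x l / ρ - i l := fun i l => by
    simp only [gridPoint]
    field_simp
  -- Only the vertices of the cell containing `x` contribute; the sum over them factors into
  -- one-dimensional sums of two hats.
  let S : Finset (Fin d → ℤ) := Fintype.piFinset fun l => {⌊x l / ρ⌋, ⌊x l / ρ⌋ + 1}
  have h : ∑ i ∈ S, basisFn ρ i x = 1 := by
    simp_rw [basisFn, harg]
    rw [← Finset.prod_univ_sum (fun l => ({⌊x l / ρ⌋, ⌊x l / ρ⌋ + 1} : Finset ℤ))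
      (fun l (n : ℤ) => hat (x l / ρ - n))]
    refine Finset.prod_eq_one fun l _ => ?_
    rw [Finset.sum_pair (by simp)]
    push_cast
    exact hat_sub_floor_add _
  rw [← h]
  refine hasSum_sum_of_ne_finset_zero fun i hi => ?_
  simp only [S, Fintype.mem_piFinset, not_forall, Finset.mem_insert, Finset.mem_singleton,
    not_or] at hi
  obtain ⟨l, h1, h2⟩ := hi
  refine Finset.prod_eq_zero (Finset.mem_univ l) ?_
  rw [harg]
  exact hat_sub_int_eq_zero h1 h2

theorem norm_gridPoint_sq_le {d : ℕ} {ρ : ℝ} {i : Fin d → ℤ} {x : Euc d}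
    (h : ∀ l, |x l - gridPoint ρ i l| ≤ ρ) :
    ‖gridPoint ρ i‖ ^ 2 ≤ 2 * ‖x‖ ^ 2 + 2 * d * ρ ^ 2 := by
  have h1 : ‖x - gridPoint ρ i‖ ^ 2 ≤ d * ρ ^ 2 := by
    rw [EuclideanSpace.norm_sq_eq]
    calc ∑ l, ‖(x - gridPoint ρ i) l‖ ^ 2 ≤ ∑ _l : Fin d, ρ ^ 2 := by
          refine Finset.sum_le_sum fun l _ => ?_
          have := h l
          rw [PiLp.sub_apply, Real.norm_eq_abs]
          gcongr
      _ = d * ρ ^ 2 := by simp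
  have h2 : ‖gridPoint ρ i‖ ≤ ‖x‖ + ‖x - gridPoint ρ i‖ := by
    have := norm_sub_le x (x - gridPoint ρ i)
    rwa [sub_sub_cancel] at this
  have h3 : ‖gridPoint ρ i‖ ^ 2 ≤ (‖x‖ + ‖x - gridPoint ρ i‖) ^ 2 := by gcongr
  nlinarith [sq_nonneg (‖x‖ - ‖x - gridPoint ρ i‖)]

/-- On the support of the basis function the grid point is within `ρ` of `x` in each coordinate;
elsewhere both sides vanish. The basis factor is kept on the right so that the bound can be summed
over `i`. -/
theorem norm_gridPoint_sq_mul_basisFn_le {d : ℕ} {ρ : ℝ} (hρ : 0 < ρ) (i : Fin d → ℤ)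
    (x : Euc d) :
    ‖gridPoint ρ i‖ ^ 2 * basisFn ρ i x ≤ (2 * ‖x‖ ^ 2 + 2 * d * ρ ^ 2) * basisFn ρ i x := by
  by_cases h : ∀ l, |x l - gridPoint ρ i l| ≤ ρ
  · exact mul_le_mul_of_nonneg_right (norm_gridPoint_sq_le h) (basisFn_nonneg _ _ _)
  · push Not at h
    obtain ⟨l, hl⟩ := h
    have : basisFn ρ i x = 0 := by
      refine Finset.prod_eq_zero (Finset.mem_univ l) (hat_eq_zero ?_)
      rw [abs_div, abs_of_pos hρ, one_le_div hρ]
      exact hl.le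
    simp [this]

/-! ### Second moments of weights on the grid -/

/-- Probability weights on the grid with second moment at most `M`. -/
structure HasMomentLE {d : ℕ} (ρ : ℝ) (w : (Fin d → ℤ) → ℝ) (M : ℝ) : Prop where
  nonneg : ∀ i, 0 ≤ w i
  hasSum : HasSum w 1
  summable : Summable fun i => ‖gridPoint ρ i‖ ^ 2 * w i
  tsum_le : ∑' i, ‖gridPoint ρ i‖ ^ 2 * w i ≤ M

theorem HasMomentLE.isGridProb {d : ℕ} {ρ M : ℝ} {w : (Fin d → ℤ) → ℝ} (h : HasMomentLE ρ w M) :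
    IsGridProb ρ w := by
  refine ⟨h.nonneg, h.hasSum, Summable.of_nonneg_of_le
    (fun i => mul_nonneg (norm_nonneg _) (h.nonneg i)) (fun i => ?_) (h.hasSum.summable.add h.summable)⟩
  have := h.nonneg i
  nlinarith [mul_nonneg (sq_nonneg (‖gridPoint ρ i‖ - 1)) this,
    mul_nonneg (sq_nonneg ‖gridPoint ρ i‖) this]

/-- Integration against the image of nonnegative weights under a nonnegative kernel. -/
theorem hasSum_mul_tsum_kernel {ι : Type*} {Q : ι → ι → ℝ} {f F w : ι → ℝ}
    (hQ : ∀ i j, 0 ≤ Q i j) (hf : ∀ i, 0 ≤ f i) (hw : ∀ j, 0 ≤ w j)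
    (hF : ∀ j, HasSum (fun i => f i * Q i j) (F j)) (hFw : Summable fun j => F j * w j)
    (hQw : ∀ i, Summable fun j => Q i j * w j) :
    HasSum (fun i => f i * ∑' j, Q i j * w j) (∑' j, F j * w j) := by
  -- Tonelli's theorem: the double family is summable by summing over `i` first, and is then summed
  -- in the other order.
  let g : ι × ι → ℝ := fun p => f p.2 * Q p.2 p.1 * w p.1
  have hfib : ∀ j, HasSum (fun i => g (j, i)) (F j * w j) := fun j => (hF j).mul_right (w j)
  have hg : Summable g := by
    rw [summable_prod_of_nonneg fun p => mul_nonneg (mul_nonneg (hf _) (hQ _ _)) (hw _)]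
    refine ⟨fun j => (hfib j).summable, hFw.congr fun j => (hfib j).tsum_eq.symm⟩
  have h1 := hg.hasSum.prod_fiberwise hfib
  have h2 := ((Equiv.prodComm ι ι).hasSum_iff (f := g)).2 hg.hasSum
  rw [← h1.tsum_eq] at h2
  refine h2.prod_fiberwise fun i => ?_
  simpa [g, mul_assoc] using (hQw i).hasSum.mul_left (f i)

/-- Tonelli's theorem with the test function `1` gives conservation of mass, and with `|x_i|²` the
growth of the second moment. -/
theorem HasMomentLE.kernel {d : ℕ} {ρ M A : ℝ} {w : (Fin d → ℤ) → ℝ} (hw : HasMomentLE ρ w M)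
    {Q : (Fin d → ℤ) → (Fin d → ℤ) → ℝ} (hA : 0 ≤ A) (hQ : ∀ i j, 0 ≤ Q i j)
    (hQ1 : ∀ j, HasSum (fun i => Q i j) 1)
    (hQs : ∀ j, Summable fun i => ‖gridPoint ρ i‖ ^ 2 * Q i j)
    (hQA : ∀ j, ∑' i, ‖gridPoint ρ i‖ ^ 2 * Q i j ≤ A * (1 + ‖gridPoint ρ j‖ ^ 2)) :
    HasMomentLE ρ (fun i => ∑' j, Q i j * w j) (A * (1 + M)) := by
  have hQw : ∀ i, Summable fun j => Q i j * w j := fun i =>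
    Summable.of_nonneg_of_le (fun j => mul_nonneg (hQ i j) (hw.nonneg j))
      (fun j => mul_le_of_le_one_left (hw.nonneg j)
        ((hQ1 j).tsum_eq ▸ (hQ1 j).summable.le_tsum i fun k _ => hQ k j)) hw.hasSum.summable
  have hbound : ∀ j, (∑' i, ‖gridPoint ρ i‖ ^ 2 * Q i j) * w j
      ≤ A * (w j + ‖gridPoint ρ j‖ ^ 2 * w j) := fun j => by
    refine (mul_le_mul_of_nonneg_right (hQA j) (hw.nonneg j)).trans (le_of_eq ?_)
    ring
  have hs : Summable fun j => A * (w j + ‖gridPoint ρ j‖ ^ 2 * w j) :=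
    (hw.hasSum.summable.add hw.summable).mul_left A
  have hFw : Summable fun j => (∑' i, ‖gridPoint ρ i‖ ^ 2 * Q i j) * w j :=
    Summable.of_nonneg_of_le (fun j => mul_nonneg (tsum_nonneg fun i =>
      mul_nonneg (sq_nonneg _) (hQ i j)) (hw.nonneg j)) hbound hs
  have h2 := hasSum_mul_tsum_kernel hQ (fun i => sq_nonneg ‖gridPoint ρ i‖) hw.nonneg
    (fun j => (hQs j).hasSum) hFw hQw
  refine ⟨fun i => tsum_nonneg fun j => mul_nonneg (hQ i j) (hw.nonneg j), ?_, h2.summable, ?_⟩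
  · have h1 := hasSum_mul_tsum_kernel (f := fun _ => 1) hQ (fun _ => zero_le_one) hw.nonneg
      (fun j => by simpa using hQ1 j) (by simpa using hw.hasSum.summable) hQw
    simpa [hw.hasSum.tsum_eq] using h1
  · rw [h2.tsum_eq]
    refine (hFw.tsum_le_tsum hbound hs).trans ?_
    rw [tsum_mul_left, hw.hasSum.summable.tsum_add hw.summable, hw.hasSum.tsum_eq]
    have := hw.tsum_le
    gcongr

/-! ### The initial weights -/

/-- Moving `x` outwards in the coordinate `l` leaves the cube at once, so `x` is not interior. -/
theorem mem_frontier_cube {d : ℕ} {ρ : ℝ} {i : Fin d → ℤ} {x : Euc d}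
    (hx : x ∈ cube ρ i) {l : Fin d} (hl : |x l - gridPoint ρ i l| = ρ / 2) :
    x ∈ frontier (cube ρ i) := by
  refine ⟨subset_closure hx, fun hint => ?_⟩
  obtain ⟨c, hc⟩ : ∃ c : ℝ, c ≠ 0 ∧ ∀ t, 0 < t → ρ / 2 < |x l + t * c - gridPoint ρ i l| := by
    rcases le_total 0 (x l - gridPoint ρ i l) with h | h
    · rw [abs_of_nonneg h] at hl
      exact ⟨1, one_ne_zero, fun t ht => lt_abs.2 (Or.inl (by linarith))⟩
    · rw [abs_of_nonpos h] at hl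
      exact ⟨-1, by norm_num, fun t ht => lt_abs.2 (Or.inr (by linarith))⟩
  have hcont : ContinuousAt (fun t : ℝ => x + t • EuclideanSpace.single l c) 0 := by fun_prop
  have hmem : ∀ᶠ t : ℝ in 𝓝 0, x + t • EuclideanSpace.single l c ∈ cube ρ i := by
    refine hcont.eventually (mem_of_superset (isOpen_interior.mem_nhds ?_) interior_subset)
    simpa using hint
  obtain ⟨t, ht, ht0⟩ := ((hmem.filter_mono nhdsWithin_le_nhds).and
    (self_mem_nhdsWithin (s := Set.Ioi (0 : ℝ)))).exists
  have h1 := ht l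
  have h2 := hc.2 t ht0
  simp only [PiLp.add_apply, PiLp.smul_apply, PiLp.single_apply, if_true,
    smul_eq_mul] at h1
  linarith

/-- In a coordinate where the indices differ the centres are at least `ρ` apart, so a common point
is at distance exactly `ρ / 2` there. Null boundaries thus make the cubes almost everywhere
disjoint. -/
theorem inter_cube_subset_frontier {d : ℕ} {ρ : ℝ} (hρ : 0 < ρ) {i j : Fin d → ℤ} (hij : i ≠ j) :
    cube ρ i ∩ cube ρ j ⊆ frontier (cube ρ i) := by
  rintro x ⟨hi, hj⟩
  obtain ⟨l, hl⟩ := Function.ne_iff.1 hij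
  refine mem_frontier_cube hi (l := l) (le_antisymm (hi l) ?_)
  have h1 := abs_sub_abs_le_abs_sub (gridPoint ρ j l - gridPoint ρ i l) (gridPoint ρ j l - x l)
  have h2 : ρ ≤ |gridPoint ρ j l - gridPoint ρ i l| := by
    have h3 : (1 : ℝ) ≤ |((j l - i l : ℤ) : ℝ)| := by
      exact_mod_cast Int.one_le_abs (sub_ne_zero.2 (Ne.symm hl))
    calc ρ = ρ * 1 := (mul_one _).symm
      _ ≤ ρ * |((j l - i l : ℤ) : ℝ)| := by gcongr
      _ = _ := by
        rw [← abs_of_pos hρ, ← abs_mul, abs_of_pos hρ]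
        simp only [gridPoint]
        push_cast
        ring_nf
  have h4 := hj l
  rw [abs_sub_comm] at h4
  rw [sub_sub_sub_cancel_left] at h1
  linarith

theorem iUnion_cube {d : ℕ} {ρ : ℝ} (hρ : 0 < ρ) :
    ⋃ i : Fin d → ℤ, cube ρ i = (Set.univ : Set (Euc d)) := by
  refine Set.eq_univ_of_forall fun x => Set.mem_iUnion.2 ⟨fun l => round (x l / ρ), fun l => ?_⟩
  have h := abs_sub_round (x l / ρ)
  have e : x l - gridPoint ρ (fun l => round (x l / ρ)) l
      = ρ * (x l / ρ - round (x l / ρ)) := by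
    simp only [gridPoint]
    field_simp
  rw [e, abs_mul, abs_of_pos hρ]
  nlinarith

theorem isClosed_cube {d : ℕ} (ρ : ℝ) (i : Fin d → ℤ) : IsClosed (cube ρ i) := by
  have : cube ρ i = ⋂ l, {x : Euc d | |x l - gridPoint ρ i l| ≤ ρ / 2} := by
    ext x; simp [cube]
  rw [this]
  exact isClosed_iInter fun l => isClosed_le (by fun_prop) continuous_const

/-- The cubes tile the space up to null sets, so their masses sum to one and the discrete second
moment is at most the integral of `2 |x|² + 2 d ρ²`. -/
theorem exists_hasMomentLE_cube {d : ℕ} {ρ : ℝ} (hρ : 0 < ρ) (m₀ : Measure (Euc d))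
    [IsProbabilityMeasure m₀] (hm : Integrable (fun x => ‖x‖ ^ 2) m₀)
    (hm' : ∀ i : Fin d → ℤ, m₀ (frontier (cube ρ i)) = 0) :
    ∃ M, HasMomentLE ρ (fun i => m₀.real (cube ρ i)) M := by
  have hmeas : ∀ i : Fin d → ℤ, NullMeasurableSet (cube ρ i) m₀ := fun i =>
    (isClosed_cube ρ i).measurableSet.nullMeasurableSet
  have hdisj : Pairwise (Function.onFun (AEDisjoint m₀) fun i : Fin d → ℤ => cube ρ i) :=
    fun i j hij => measure_mono_null (inter_cube_subset_frontier hρ hij) (hm' i)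
  have h1 : ∑' i : Fin d → ℤ, m₀ (cube ρ i) = 1 := by
    rw [← measure_iUnion₀ hdisj hmeas, iUnion_cube hρ, measure_univ]
  have h2 : ∑' i : Fin d → ℤ, ENNReal.ofReal (‖gridPoint ρ i‖ ^ 2) * m₀ (cube ρ i) ≠ ∞ := by
    have hint : Integrable (fun x : Euc d => 2 * ‖x‖ ^ 2 + 2 * d * ρ ^ 2) m₀ :=
      (hm.const_mul 2).add (integrable_const _)
    refine ne_top_of_le_ne_top hint.lintegral_lt_top.ne ?_
    calc ∑' i : Fin d → ℤ, ENNReal.ofReal (‖gridPoint ρ i‖ ^ 2) * m₀ (cube ρ i)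
        = ∑' i : Fin d → ℤ, ∫⁻ _x in cube ρ i, ENNReal.ofReal (‖gridPoint ρ i‖ ^ 2) ∂m₀ := by
          simp_rw [setLIntegral_const]
      _ ≤ ∑' i : Fin d → ℤ, ∫⁻ x in cube ρ i,
            ENNReal.ofReal (2 * ‖x‖ ^ 2 + 2 * d * ρ ^ 2) ∂m₀ := by
          refine ENNReal.tsum_le_tsum fun i =>
            setLIntegral_mono' (isClosed_cube ρ i).measurableSet fun x hx => ?_
          exact ENNReal.ofReal_le_ofReal
            (norm_gridPoint_sq_le fun l => (hx l).trans (by linarith))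
      _ = ∫⁻ x, ENNReal.ofReal (2 * ‖x‖ ^ 2 + 2 * d * ρ ^ 2) ∂m₀ := by
          rw [← lintegral_iUnion₀ hmeas hdisj, iUnion_cube hρ, setLIntegral_univ]
  refine ⟨_, fun i => measureReal_nonneg, ?_, ?_, le_rfl⟩
  · have := ENNReal.hasSum_toReal (h1.trans_ne ENNReal.one_ne_top)
    rwa [← ENNReal.tsum_toReal_eq (fun i => measure_ne_top _ _), h1, ENNReal.toReal_one] at this
  · refine (ENNReal.summable_toReal h2).congr fun i => ?_
    rw [ENNReal.toReal_mul, ENNReal.toReal_ofReal (sq_nonneg _), measureReal_def]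

/-! ### The transition kernel of the scheme -/

theorem norm_column_le {d r : ℕ} (A : Matrix (Fin d) (Fin r) ℝ) (l : Fin r) :
    ‖column A l‖ ≤ frob A := by
  rw [EuclideanSpace.norm_eq, frob]
  refine Real.sqrt_le_sqrt (Finset.sum_le_sum fun i _ => ?_)
  rw [Real.norm_eq_abs, sq_abs]
  exact Finset.single_le_sum (f := fun j => A i j ^ 2) (fun j _ => sq_nonneg _) (Finset.mem_univ l)

section Scheme

variable {d r N : ℕ} {T : ℝ} (hT : 0 < T) (ρ : ℝ)
  (b : Curves d T × Euc d × Set.Icc (0 : ℝ) T → Euc d)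
  (σ : Curves d T × Euc d × Set.Icc (0 : ℝ) T → Matrix (Fin d) (Fin r) ℝ)

/-- The transition probability from `x_j` to `x_i` at time `t_k`, along the curve `μ`. -/
def transition (μ : Curves d T) (k : Fin (N + 1)) (i j : Fin d → ℤ) : ℝ :=
  1 / (2 * (r : ℝ)) * ∑ l : Fin r, (basisFn ρ i (Phi hT ρ b σ μ 1 j k l)
    + basisFn ρ i (Phi hT ρ b σ μ (-1) j k l))

theorem transition_nonneg (μ : Curves d T) (k : Fin (N + 1)) (i j : Fin d → ℤ) :
    0 ≤ transition hT ρ b σ μ k i j :=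
  mul_nonneg (by positivity) (Finset.sum_nonneg fun _ _ =>
    add_nonneg (basisFn_nonneg _ _ _) (basisFn_nonneg _ _ _))

variable {ρ b σ}

theorem hasSum_transition (hr : 0 < r) (hρ : 0 < ρ) (μ : Curves d T) (k : Fin (N + 1))
    (j : Fin d → ℤ) : HasSum (fun i => transition hT ρ b σ μ k i j) 1 := by
  have h := (hasSum_sum (s := Finset.univ) fun (l : Fin r) _ =>
    (hasSum_basisFn hρ (Phi hT ρ b σ μ 1 j k l)).add
      (hasSum_basisFn hρ (Phi hT ρ b σ μ (-1) j k l))).mul_left (1 / (2 * (r : ℝ)))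
  have hr' : (r : ℝ) ≠ 0 := by exact_mod_cast hr.ne'
  have e : 1 / (2 * (r : ℝ)) * ∑ _l : Fin r, ((1 : ℝ) + 1) = 1 := by
    simp
    field_simp
    norm_num
  rwa [e] at h

theorem exists_norm_Phi_sq_le (hN : 0 < N) (hbσ : AssumptionH b σ) :
    ∃ D ≥ 0, ∀ (μ : Curves d T) (ε : ℝ) (_ : |ε| = 1) (j : Fin d → ℤ) (k : Fin (N + 1)) (l : Fin r),
      ‖Phi hT ρ b σ μ ε j k l‖ ^ 2 ≤ D * (1 + ‖gridPoint ρ j‖ ^ 2) := by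
  obtain ⟨C, hC, hg⟩ := hbσ.linear_growth
  have hh : 0 < T / N := by positivity
  set s := Real.sqrt (r * (T / N))
  have hs : 0 ≤ s := Real.sqrt_nonneg _
  -- Linear growth gives `|Φ| ≤ (1 + (h + s) C) (1 + |x_j|)`; the factor `2` comes from `(1 + X)² ≤
  -- 2 (1 + X²)`. The constant does not involve the curve.
  refine ⟨2 * (1 + (T / N + s) * C) ^ 2, by positivity, fun μ ε hε j k l => ?_⟩
  have h0 := hg μ (gridPoint ρ j) (timeNode T N hT k)
  set X := ‖gridPoint ρ j‖
  have hX : 0 ≤ X := norm_nonneg _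
  have hf : 0 ≤ frob (σ (μ, gridPoint ρ j, timeNode T N hT k)) := Real.sqrt_nonneg _
  have hb0 := norm_nonneg (b (μ, gridPoint ρ j, timeNode T N hT k))
  have h1 : ‖Phi hT ρ b σ μ ε j k l‖ ≤ (1 + (T / N + s) * C) * (1 + X) := by
    refine (norm_add₃_le).trans ?_
    rw [norm_smul, norm_smul, norm_mul, Real.norm_of_nonneg hh.le, Real.norm_eq_abs, hε, one_mul,
      Real.norm_of_nonneg hs]
    have h2 : T / N * ‖b (μ, gridPoint ρ j, timeNode T N hT k)‖ ≤ T / N * (C * (1 + X)) := by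
      gcongr; linarith
    have h3 : s * ‖column (σ (μ, gridPoint ρ j, timeNode T N hT k)) l‖ ≤ s * (C * (1 + X)) := by
      gcongr
      linarith [norm_column_le (σ (μ, gridPoint ρ j, timeNode T N hT k)) l]
    change X + _ + _ ≤ _
    linarith
  calc ‖Phi hT ρ b σ μ ε j k l‖ ^ 2 ≤ ((1 + (T / N + s) * C) * (1 + X)) ^ 2 := by gcongr
    _ = (1 + (T / N + s) * C) ^ 2 * (1 + X) ^ 2 := by ring
    _ ≤ (1 + (T / N + s) * C) ^ 2 * (2 * (1 + X ^ 2)) := by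
      gcongr
      nlinarith [sq_nonneg (1 - X)]
    _ = _ := by ring

theorem exists_transition_moment_le (hr : 0 < r) (hN : 0 < N) (hρ : 0 < ρ)
    (hbσ : AssumptionH b σ) :
    ∃ A ≥ 0, ∀ (μ : Curves d T) (k : Fin (N + 1)) (j : Fin d → ℤ),
      (Summable fun i => ‖gridPoint ρ i‖ ^ 2 * transition hT ρ b σ μ k i j) ∧
      ∑' i, ‖gridPoint ρ i‖ ^ 2 * transition hT ρ b σ μ k i j
        ≤ A * (1 + ‖gridPoint ρ j‖ ^ 2) := by
  obtain ⟨D, hD, h⟩ := exists_norm_Phi_sq_le (N := N) (ρ := ρ) hT hN hbσ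
  refine ⟨2 * D + 2 * d * ρ ^ 2, by positivity, fun μ k j => ?_⟩
  set A := (2 * D + 2 * d * ρ ^ 2) * (1 + ‖gridPoint ρ j‖ ^ 2)
  have hβ : ∀ (ε : ℝ) (_ : |ε| = 1) (l : Fin r) (i : Fin d → ℤ),
      ‖gridPoint ρ i‖ ^ 2 * basisFn ρ i (Phi hT ρ b σ μ ε j k l)
        ≤ A * basisFn ρ i (Phi hT ρ b σ μ ε j k l) := fun ε hε l i => by
    refine (norm_gridPoint_sq_mul_basisFn_le hρ _ _).trans
      (mul_le_mul_of_nonneg_right ?_ (basisFn_nonneg _ _ _))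
    have h1 := h μ ε hε j k l
    have h2 : 0 ≤ 2 * d * ρ ^ 2 * ‖gridPoint ρ j‖ ^ 2 := by positivity
    simp only [A]
    linarith
  have hle : ∀ i, ‖gridPoint ρ i‖ ^ 2 * transition hT ρ b σ μ k i j
      ≤ A * transition hT ρ b σ μ k i j := fun i => by
    rw [transition, mul_left_comm, mul_left_comm A]
    refine mul_le_mul_of_nonneg_left ?_ (by positivity)
    rw [Finset.mul_sum, Finset.mul_sum]
    refine Finset.sum_le_sum fun l _ => ?_
    rw [mul_add, mul_add]
    exact add_le_add (hβ 1 (by simp) l i) (hβ (-1) (by simp) l i)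
  have hs := (hasSum_transition (b := b) (σ := σ) hT hr hρ μ k j).mul_left A
  have hsum := Summable.of_nonneg_of_le (fun i => mul_nonneg (sq_nonneg _)
    (transition_nonneg hT ρ b σ μ k i j)) hle hs.summable
  refine ⟨hsum, ?_⟩
  rw [← mul_one A, ← hs.tsum_eq]
  exact hsum.tsum_le_tsum hle hs.summable

/-- Exchanging the sum over `ℓ` with the series over `j` requires summability at the previous level,
which the moment induction supplies. -/
theorem schemeMap_succ (hN : 0 < N) (m₀ : Measure (Euc d)) (μ : gridWeights d N ρ) (k : Fin N)
    (hs : Summable (schemeMap hT hN m₀ b σ μ k.castSucc)) (i : Fin d → ℤ) :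
    schemeMap hT hN m₀ b σ μ k.succ i
      = ∑' j, transition hT ρ b σ (interp hT hN μ) k.castSucc i j
        * schemeMap hT hN m₀ b σ μ k.castSucc j := by
  have e : schemeMap hT hN m₀ b σ μ k.succ i = 1 / (2 * (r : ℝ)) * ∑ l : Fin r, ∑' j,
      (basisFn ρ i (Phi hT ρ b σ (interp hT hN μ) 1 j k.castSucc l)
        + basisFn ρ i (Phi hT ρ b σ (interp hT hN μ) (-1) j k.castSucc l))
        * schemeMap hT hN m₀ b σ μ k.castSucc j := rfl
  rw [e, ← Summable.tsum_finsetSum, ← tsum_mul_left]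
  · refine tsum_congr fun j => ?_
    rw [← Finset.sum_mul, ← mul_assoc, transition]
  · intro l _
    refine Summable.of_norm_bounded (hs.norm.mul_left 2) fun j => ?_
    have h1 := basisFn_nonneg ρ i (Phi hT ρ b σ (interp hT hN μ) 1 j k.castSucc l)
    have h2 := basisFn_nonneg ρ i (Phi hT ρ b σ (interp hT hN μ) (-1) j k.castSucc l)
    have h3 := basisFn_le_one ρ i (Phi hT ρ b σ (interp hT hN μ) 1 j k.castSucc l)
    have h4 := basisFn_le_one ρ i (Phi hT ρ b σ (interp hT hN μ) (-1) j k.castSucc l)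
    rw [norm_mul, Real.norm_of_nonneg (add_nonneg h1 h2)]
    gcongr
    linarith

/-- The scheme produces probability weights whose second moments are bounded uniformly with
respect to the curve along which the coefficients are evaluated. -/
theorem exists_hasMomentLE_schemeMap (hr : 0 < r) (hN : 0 < N) (hρ : 0 < ρ)
    (hbσ : AssumptionH b σ) (m₀ : Measure (Euc d)) [IsProbabilityMeasure m₀]
    (hm : Integrable (fun x => ‖x‖ ^ 2) m₀)
    (hm' : ∀ i : Fin d → ℤ, m₀ (frontier (cube ρ i)) = 0) :
    ∃ M, ∀ (μ : gridWeights d N ρ) (k : Fin (N + 1)),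
      HasMomentLE ρ (schemeMap hT hN m₀ b σ μ k) M := by
  obtain ⟨A, hA, hmom⟩ := exists_transition_moment_le (N := N) hT hr hN hρ hbσ
  -- The bound is chosen before `μ`, so the induction keeps it uniform in the curve; there are
  -- finitely many levels.
  have hk : ∀ k : Fin (N + 1), ∃ M, ∀ μ : gridWeights d N ρ,
      HasMomentLE ρ (schemeMap hT hN m₀ b σ μ k) M := fun k => by
    induction k using Fin.induction with
    | zero =>
      obtain ⟨M, hM⟩ := exists_hasMomentLE_cube hρ m₀ hm hm'
      exact ⟨M, fun μ => hM⟩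
    | succ k ih =>
      obtain ⟨M, hM⟩ := ih
      refine ⟨A * (1 + M), fun μ => ?_⟩
      have := (hM μ).kernel hA (transition_nonneg hT ρ b σ (interp hT hN μ) k.castSucc)
        (hasSum_transition hT hr hρ _ _) (fun j => (hmom _ _ j).1) (fun j => (hmom _ _ j).2)
      convert this using 1
      exact funext fun i => schemeMap_succ hT hN m₀ μ k (hM μ).hasSum.summable i
  choose M hM using hk
  obtain ⟨B, hB⟩ := Finset.exists_le (Finset.univ.image M)
  exact ⟨B, fun μ k => { hM k μ with
    tsum_le := (hM k μ).tsum_le.trans (hB _ (Finset.mem_image_of_mem _ (Finset.mem_univ k))) }⟩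

end Scheme

/-! ### Passage to the limit under a moment bound -/

/-- Convergence of series under a bound on a moment of higher order. -/
theorem tendsto_tsum_of_moment_le {α ι : Type*} {l : Filter α} {V c : ι → ℝ}
    (hV : ∀ i, 0 ≤ V i) (hc : ∀ ε > 0, {i | ε * V i < c i}.Finite)
    {u : α → ι → ℝ} {M : ℝ} (hu : ∀ a i, 0 ≤ u a i) (hus : ∀ a, Summable fun i => V i * u a i)
    (huM : ∀ a, ∑' i, V i * u a i ≤ M) {f : α → ι → ℝ} {g : ι → ℝ}
    (hf : ∀ a i, |f a i| ≤ c i * u a i) (hfs : ∀ a, Summable (f a)) (hg : Summable g)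
    (hfg : ∀ i, Tendsto (fun a => f a i) l (𝓝 (g i))) :
    Tendsto (fun a => ∑' i, f a i) l (𝓝 (∑' i, g i)) := by
  classical
  rw [Metric.tendsto_nhds]
  intro ε hε
  set δ := ε / (4 * max M 1) with hδ
  have hM1 : (0 : ℝ) < max M 1 := lt_of_lt_of_le one_pos (le_max_right _ _)
  have hδ0 : 0 < δ := by positivity
  obtain ⟨s₀, hs₀⟩ := (Metric.tendsto_atTop.1 hg.hasSum) (ε / 4) (by positivity)
  -- Here `s₀` controls the tail of `g`. Outside the second set `c ≤ δ V`, so the tail of each `f a`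
  -- is at most `δ M ≤ ε / 4`.
  set s := s₀ ∪ (hc δ hδ0).toFinset
  have hgs := hs₀ s Finset.subset_union_left
  have htail : ∀ a, |∑' i, f a i - ∑ i ∈ s, f a i| ≤ ε / 4 := fun a => by
    rw [← (hfs a).sum_add_tsum_subtype_compl s, add_sub_cancel_left]
    have hsub : Summable fun i : {i // i ∉ s} => δ * (V i * u a i) :=
      ((hus a).mul_left δ).subtype _
    have hle : ∀ i : {i // i ∉ s}, ‖f a i‖ ≤ δ * (V i * u a i) := fun i => by
      have hi : ¬ (δ * V i < c i) := fun h =>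
        i.2 (Finset.mem_union_right _ ((hc δ hδ0).mem_toFinset.2 h))
      rw [← mul_assoc]
      exact (hf a i).trans (mul_le_mul_of_nonneg_right (not_lt.1 hi) (hu a i))
    calc |∑' i : {i // i ∉ s}, f a i| ≤ ∑' i : {i // i ∉ s}, δ * (V i * u a i) :=
          tsum_of_norm_bounded hsub.hasSum hle
      _ ≤ ∑' i, δ * (V i * u a i) :=
          ((hus a).mul_left δ).tsum_subtype_le _ {i | i ∉ s} fun i =>
            mul_nonneg hδ0.le (mul_nonneg (hV i) (hu a i))
      _ ≤ δ * max M 1 := by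
          rw [tsum_mul_left]
          gcongr
          exact (huM a).trans (le_max_left _ _)
      _ = ε / 4 := by rw [hδ]; field_simp
  have hfin : Tendsto (fun a => ∑ i ∈ s, f a i) l (𝓝 (∑ i ∈ s, g i)) :=
    tendsto_finsetSum _ fun i _ => hfg i
  filter_upwards [Metric.tendsto_nhds.1 hfin (ε / 4) (by positivity)] with a ha
  have h1 := htail a
  rw [Real.dist_eq] at *
  have h2 := abs_sub_le (∑' i, f a i) (∑ i ∈ s, f a i) (∑' i, g i)
  have h3 := abs_sub_le (∑ i ∈ s, f a i) (∑ i ∈ s, g i) (∑' i, g i)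
  linarith

theorem finite_norm_gridPoint_le {d : ℕ} {ρ : ℝ} (hρ : 0 < ρ) (R : ℝ) :
    {i : Fin d → ℤ | ‖gridPoint ρ i‖ ≤ R}.Finite := by
  refine (Set.finite_Icc (fun _ => -⌈R / ρ⌉) (fun _ => ⌈R / ρ⌉)).subset fun i hi => ?_
  have h : ∀ l, |(i l : ℝ)| ≤ ⌈R / ρ⌉ := fun l => by
    refine le_trans ?_ (Int.le_ceil _)
    rw [le_div_iff₀ hρ]
    have h1 := (PiLp.norm_apply_le (gridPoint ρ i) l).trans hi
    simp only [gridPoint, norm_mul, Real.norm_eq_abs, abs_of_pos hρ] at h1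
    linarith
  exact ⟨fun l => by exact_mod_cast (abs_le.1 (h l)).1, fun l => by
    exact_mod_cast (abs_le.1 (h l)).2⟩

/-- The second moment dominates the first at infinity; this lets first moments pass to the limit. -/
theorem finite_norm_gridPoint_sq_lt {d : ℕ} {ρ : ℝ} (hρ : 0 < ρ) (ε : ℝ) (hε : 0 < ε) :
    {i : Fin d → ℤ | ε * ‖gridPoint ρ i‖ ^ 2 < ‖gridPoint ρ i‖}.Finite := by
  refine (finite_norm_gridPoint_le hρ (1 / ε)).subset fun i hi => ?_
  by_contra h
  rw [Set.mem_ofPred_eq, not_le, div_lt_iff₀ hε] at h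
  rw [Set.mem_ofPred_eq] at hi
  nlinarith [norm_nonneg (gridPoint ρ i)]

theorem finite_norm_gridPoint_sq_lt_one {d : ℕ} {ρ : ℝ} (hρ : 0 < ρ) (ε : ℝ) (hε : 0 < ε) :
    {i : Fin d → ℤ | ε * ‖gridPoint ρ i‖ ^ 2 < 1}.Finite := by
  refine (finite_norm_gridPoint_le hρ (max 1 (1 / ε))).subset fun i hi => ?_
  by_contra h
  rw [Set.mem_ofPred_eq, not_le, max_lt_iff, div_lt_iff₀ hε] at h
  rw [Set.mem_ofPred_eq] at hi
  nlinarith [norm_nonneg (gridPoint ρ i)]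

/-- Pointwise limits of weights with uniformly bounded second moments. -/
theorem HasMomentLE.of_tendsto {α : Type*} {l : Filter α} [l.NeBot] {d : ℕ} {ρ M : ℝ} (hρ : 0 < ρ)
    {u : α → (Fin d → ℤ) → ℝ} {w : (Fin d → ℤ) → ℝ} (hu : ∀ a, HasMomentLE ρ (u a) M)
    (hw : ∀ i, Tendsto (fun a => u a i) l (𝓝 (w i))) : HasMomentLE ρ w M := by
  have hw0 : ∀ i, 0 ≤ w i := fun i => ge_of_tendsto' (hw i) fun a => (hu a).nonneg i
  have hws : Summable w := summable_of_sum_le hw0 fun s =>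
    le_of_tendsto' (tendsto_finsetSum s fun i _ => hw i) fun a =>
      sum_le_hasSum s (fun i _ => (hu a).nonneg i) (hu a).hasSum
  have hle : ∀ s : Finset (Fin d → ℤ), ∑ i ∈ s, ‖gridPoint ρ i‖ ^ 2 * w i ≤ M := fun s =>
    le_of_tendsto' (tendsto_finsetSum s fun i _ => (hw i).const_mul (‖gridPoint ρ i‖ ^ 2))
      fun a => ((hu a).summable.sum_le_tsum s
        fun i _ => mul_nonneg (sq_nonneg _) ((hu a).nonneg i)).trans (hu a).tsum_le
  have h0 : ∀ i, 0 ≤ ‖gridPoint ρ i‖ ^ 2 * w i := fun i => mul_nonneg (sq_nonneg _) (hw0 i)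
  -- Pointwise limits alone give total mass at most one; the moment bound prevents mass from
  -- escaping to infinity.
  have hsum := tendsto_tsum_of_moment_le (c := fun _ => 1) (fun i => sq_nonneg ‖gridPoint ρ i‖)
    (finite_norm_gridPoint_sq_lt_one hρ) (fun a => (hu a).nonneg) (fun a => (hu a).summable)
    (fun a => (hu a).tsum_le) (f := u)
    (fun a i => by rw [one_mul, abs_of_nonneg ((hu a).nonneg i)])
    (fun a => (hu a).hasSum.summable) hws hw
  simp_rw [fun a => (hu a).hasSum.tsum_eq] at hsum
  refine ⟨hw0, ?_, summable_of_sum_le h0 hle, Real.tsum_le_of_sum_le h0 hle⟩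
  rw [tendsto_nhds_unique tendsto_const_nhds hsum]
  exact hws.hasSum

/-- Pointwise convergence with bounded second moments implies uniform convergence of the
interpolated curves with respect to `dist1`. -/
theorem tendsto_interp {α : Type*} {l : Filter α} {d N : ℕ} {ρ T M : ℝ} (hT : 0 < T) (hN : 0 < N)
    (hρ : 0 < ρ) {μ : α → gridWeights d N ρ} {ν : gridWeights d N ρ}
    (hμ : ∀ a k, HasMomentLE ρ ((μ a : GridArray d N) k) M)
    (hν : ∀ k, HasMomentLE ρ ((ν : GridArray d N) k) M)
    (h : ∀ k i, Tendsto (fun a => (μ a : GridArray d N) k i) l (𝓝 ((ν : GridArray d N) k i))) :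
    Tendsto (fun a => interp hT hN (μ a)) l (𝓝 (interp hT hN ν)) := by
  -- The first moment of the difference at a time node. Since the hats are at most one, twice the
  -- sum of these bounds the distance of the curves at every time.
  let S : α → Fin (N + 1) → ℝ := fun a k =>
    ∑' i, ‖gridPoint ρ i‖ * |(μ a : GridArray d N) k i - (ν : GridArray d N) k i|
  have habs : ∀ a k i, |(μ a : GridArray d N) k i - (ν : GridArray d N) k i|
      ≤ (μ a : GridArray d N) k i + (ν : GridArray d N) k i := fun a k i => by
    have h1 := (hμ a k).nonneg i
    have h2 := (hν k).nonneg i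
    exact abs_le.2 ⟨by linarith, by linarith⟩
  have hSs : ∀ a k, Summable fun i =>
      ‖gridPoint ρ i‖ * |(μ a : GridArray d N) k i - (ν : GridArray d N) k i| := fun a k =>
    Summable.of_nonneg_of_le (fun i => mul_nonneg (norm_nonneg _) (abs_nonneg _))
      (fun i => (mul_le_mul_of_nonneg_left (habs a k i) (norm_nonneg _)).trans_eq (mul_add _ _ _))
      (((μ a).2 k).2.2.add (ν.2 k).2.2)
  have hS : ∀ k, Tendsto (fun a => S a k) l (𝓝 0) := fun k => by
    have h1 := tendsto_tsum_of_moment_le (l := l) (c := fun i => ‖gridPoint ρ i‖)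
      (u := fun a i => (μ a : GridArray d N) k i + (ν : GridArray d N) k i) (M := M + M)
      (f := fun a i => ‖gridPoint ρ i‖ * |(μ a : GridArray d N) k i - (ν : GridArray d N) k i|)
      (g := fun _ => 0) (fun i => sq_nonneg ‖gridPoint ρ i‖) (finite_norm_gridPoint_sq_lt hρ)
      (fun a i => add_nonneg ((hμ a k).nonneg i) ((hν k).nonneg i))
      (fun a => by simpa only [mul_add] using (hμ a k).summable.add (hν k).summable)
      (fun a => by
        simp only [mul_add]
        rw [(hμ a k).summable.tsum_add (hν k).summable]
        exact add_le_add (hμ a k).tsum_le (hν k).tsum_le)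
      (fun a i => by
        rw [abs_of_nonneg (mul_nonneg (norm_nonneg _) (abs_nonneg _))]
        exact mul_le_mul_of_nonneg_left (habs a k i) (norm_nonneg _))
      (fun a => hSs a k) summable_zero
      (fun i => by simpa using (((h k i).sub_const ((ν : GridArray d N) k i)).abs.const_mul
        ‖gridPoint ρ i‖))
    simpa using h1
  have hbound : ∀ a (t : Set.Icc (0 : ℝ) T),
      edist (interp hT hN ν t) (interp hT hN (μ a) t) ≤ 2 * ∑ k, ENNReal.ofReal (S a k) := by
    intro a t
    rw [edist_comm]
    refine (dist1_gridMeasure_le (interpWeights_mem hT hN (μ a).2 t.2)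
      (interpWeights_mem hT hN ν.2 t.2)).trans ?_
    gcongr
    have e : ∀ k, ENNReal.ofReal (S a k) = ∑' i, ENNReal.ofReal
        (‖gridPoint ρ i‖ * |(μ a : GridArray d N) k i - (ν : GridArray d N) k i|) := fun k =>
      ENNReal.ofReal_tsum_of_nonneg
        (fun i => mul_nonneg (norm_nonneg _) (abs_nonneg _)) (hSs a k)
    simp_rw [e]
    rw [← Summable.tsum_finsetSum fun _ _ => ENNReal.summable]
    refine ENNReal.tsum_le_tsum fun i => ?_
    rw [← ENNReal.ofReal_sum_of_nonneg fun k _ => mul_nonneg (norm_nonneg _) (abs_nonneg _),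
      ← ofReal_norm, ← ENNReal.ofReal_mul (abs_nonneg _), ← Finset.mul_sum, mul_comm]
    refine ENNReal.ofReal_le_ofReal (mul_le_mul_of_nonneg_left ?_ (norm_nonneg _))
    rw [interpWeights, interpWeights, ← Finset.sum_sub_distrib]
    refine (Finset.abs_sum_le_sum_abs _ _).trans (Finset.sum_le_sum fun k _ => ?_)
    rw [← mul_sub, abs_mul, abs_of_nonneg (hat_nonneg _)]
    exact mul_le_of_le_one_left (abs_nonneg _) (hat_le_one _)
  have hlim : Tendsto (fun a => 2 * ∑ k, ENNReal.ofReal (S a k)) l (𝓝 0) := by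
    have h1 : Tendsto (fun a => 2 * ∑ k, ENNReal.ofReal (S a k)) l
        (𝓝 (2 * ∑ _k : Fin (N + 1), ENNReal.ofReal 0)) :=
      ENNReal.Tendsto.const_mul (tendsto_finsetSum _ fun k _ =>
        (ENNReal.continuous_ofReal.tendsto 0).comp (hS k)) (Or.inr ENNReal.ofNat_ne_top)
    simpa using h1
  rw [ContinuousMap.tendsto_iff_tendstoUniformly, EMetric.tendstoUniformly_iff]
  intro ε hε
  filter_upwards [hlim.eventually (gt_mem_nhds hε)] with a ha t
  exact (hbound a t).trans_lt ha

/-! ### Continuity of the scheme -/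

section Scheme

variable {d r N : ℕ} {T ρ : ℝ} (hT : 0 < T)
  {b : Curves d T × Euc d × Set.Icc (0 : ℝ) T → Euc d}
  {σ : Curves d T × Euc d × Set.Icc (0 : ℝ) T → Matrix (Fin d) (Fin r) ℝ}

theorem continuous_Phi (hb : Continuous b) (hσ : Continuous σ) (ε : ℝ) (j : Fin d → ℤ)
    (k : Fin (N + 1)) (l : Fin r) : Continuous fun μ => Phi hT ρ b σ μ ε j k l := by
  have h1 : Continuous fun μ => b (μ, gridPoint ρ j, timeNode T N hT k) := by fun_prop
  have h2 : Continuous fun μ => σ (μ, gridPoint ρ j, timeNode T N hT k) := by fun_prop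
  have h3 : Continuous fun μ => column (σ (μ, gridPoint ρ j, timeNode T N hT k)) l := by
    unfold column
    fun_prop
  unfold Phi
  fun_prop

theorem continuous_transition (hb : Continuous b) (hσ : Continuous σ) (k : Fin (N + 1))
    (i j : Fin d → ℤ) : Continuous fun μ => transition hT ρ b σ μ k i j := by
  unfold transition
  have h := fun ε l => (continuous_basisFn ρ i).comp
    (continuous_Phi (ρ := ρ) (N := N) hT hb hσ ε j k l)
  exact continuous_const.mul (continuous_finsetSum _ fun l _ => (h 1 l).add (h (-1) l))

/-- Continuity of the scheme with respect to pointwise convergence, under a bound on second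
moments. -/
theorem tendsto_schemeMap {α : Type*} {l : Filter α} (hr : 0 < r) (hN : 0 < N) (hρ : 0 < ρ)
    (hbσ : AssumptionH b σ) (m₀ : Measure (Euc d)) [IsProbabilityMeasure m₀]
    (hm : Integrable (fun x => ‖x‖ ^ 2) m₀)
    (hm' : ∀ i : Fin d → ℤ, m₀ (frontier (cube ρ i)) = 0) {M : ℝ}
    {μ : α → gridWeights d N ρ} {ν : gridWeights d N ρ}
    (hμ : ∀ a k, HasMomentLE ρ ((μ a : GridArray d N) k) M)
    (hν : ∀ k, HasMomentLE ρ ((ν : GridArray d N) k) M)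
    (h : ∀ k i, Tendsto (fun a => (μ a : GridArray d N) k i) l (𝓝 ((ν : GridArray d N) k i)))
    (k : Fin (N + 1)) (i : Fin d → ℤ) :
    Tendsto (fun a => schemeMap hT hN m₀ b σ (μ a) k i) l (𝓝 (schemeMap hT hN m₀ b σ ν k i)) := by
  obtain ⟨B, hB⟩ := exists_hasMomentLE_schemeMap hT hr hN hρ hbσ m₀ hm hm'
  have hint := tendsto_interp hT hN hρ hμ hν h
  induction k using Fin.induction generalizing i with
  | zero => exact tendsto_const_nhds
  | succ k ih =>
    have hs : ∀ μ, Summable (schemeMap hT hN m₀ b σ μ k.castSucc) := fun μ =>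
      (hB μ k.castSucc).hasSum.summable
    have hle : ∀ (μ : gridWeights d N ρ) j,
        |transition hT ρ b σ (interp hT hN μ) k.castSucc i j
          * schemeMap hT hN m₀ b σ μ k.castSucc j|
          ≤ 1 * schemeMap hT hN m₀ b σ μ k.castSucc j := fun μ j => by
      have h1 := hasSum_transition (b := b) (σ := σ) hT hr hρ (interp hT hN μ) k.castSucc j
      rw [abs_mul, abs_of_nonneg ((hB μ k.castSucc).nonneg j),
        abs_of_nonneg (transition_nonneg hT ρ b σ _ _ _ _)]
      refine mul_le_mul_of_nonneg_right ?_ ((hB μ k.castSucc).nonneg j)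
      rw [← h1.tsum_eq]
      exact h1.summable.le_tsum i fun i' _ => transition_nonneg hT ρ b σ _ _ _ _
    have hs' : ∀ μ : gridWeights d N ρ, Summable fun j =>
        transition hT ρ b σ (interp hT hN μ) k.castSucc i j
          * schemeMap hT hN m₀ b σ μ k.castSucc j := fun μ =>
      Summable.of_norm_bounded (by simpa using hs μ) (hle μ)
    simp_rw [fun μ => schemeMap_succ hT hN m₀ μ k (hs μ) i]
    -- Each term converges, the kernel by continuity of the coefficients along the curves and the
    -- weight by induction; the uniform output bound `B` controls the series.
    exact tendsto_tsum_of_moment_le (c := fun _ => 1) (fun i => sq_nonneg ‖gridPoint ρ i‖)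
      (finite_norm_gridPoint_sq_lt_one hρ) (fun a => (hB (μ a) k.castSucc).nonneg)
      (fun a => (hB (μ a) k.castSucc).summable) (fun a => (hB (μ a) k.castSucc).tsum_le)
      (fun a => hle (μ a)) (fun a => hs' (μ a)) (hs' ν) fun j =>
      (((continuous_transition hT hbσ.continuous_b hbσ.continuous_σ k.castSucc i j).tendsto
        _).comp hint).mul (ih j)

end Scheme

/-! ### Truncation to finitely many grid points -/

open Classical in
/-- Probability weights on `B ∪ {0}` made from the positive parts of the values on `B` of an
arbitrary function: they are divided by their sum if it exceeds `1`, and missing mass is placed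
at the origin. -/
def truncWeights {d : ℕ} (B : Finset (Fin d → ℤ)) (y : (Fin d → ℤ) → ℝ) (i : Fin d → ℤ) : ℝ :=
  (if i ∈ B then max (y i) 0 / max 1 (∑ j ∈ B, max (y j) 0) else 0)
    + if i = 0 then 1 - (∑ j ∈ B, max (y j) 0) / max 1 (∑ j ∈ B, max (y j) 0) else 0

theorem truncWeights_congr {d : ℕ} {B : Finset (Fin d → ℤ)} {y z : (Fin d → ℤ) → ℝ}
    (h : ∀ i ∈ B, y i = z i) : truncWeights B y = truncWeights B z := by
  have hs : ∑ j ∈ B, max (y j) 0 = ∑ j ∈ B, max (z j) 0 :=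
    Finset.sum_congr rfl fun j hj => by rw [h j hj]
  funext i
  unfold truncWeights
  rw [hs]
  congr 1
  split_ifs with hi
  · rw [h i hi]
  · rfl

-- Genuine probability weights have mass at most one on `B`, so no division takes place.
open Classical in
theorem truncWeights_of_hasSum {d : ℕ} (B : Finset (Fin d → ℤ)) {y : (Fin d → ℤ) → ℝ}
    (h0 : ∀ i, 0 ≤ y i) (h1 : HasSum y 1) (i : Fin d → ℤ) :
    truncWeights B y i
      = (if i ∈ B then y i else 0) + if i = 0 then 1 - ∑ j ∈ B, y j else 0 := by
  have hs : ∑ j ∈ B, y j ≤ 1 := sum_le_hasSum B (fun i _ => h0 i) h1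
  simp [truncWeights, h0, hs]

/-- The mass added at the origin contributes nothing to the second moment. -/
theorem hasMomentLE_truncWeights {d : ℕ} (ρ : ℝ) (B : Finset (Fin d → ℤ)) (y : (Fin d → ℤ) → ℝ) :
    HasMomentLE ρ (truncWeights B y)
      (∑ i ∈ B, ‖gridPoint ρ i‖ ^ 2 * (max (y i) 0 / max 1 (∑ j ∈ B, max (y j) 0))) := by
  classical
  set s := ∑ j ∈ B, max (y j) 0 with hs
  have hs1 : 0 < max 1 s := lt_of_lt_of_le one_pos (le_max_left _ _)
  have hfin : ∀ c : (Fin d → ℤ) → ℝ, HasSum (fun i => if i ∈ B then c i else 0) (∑ i ∈ B, c i) :=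
    fun c => by
      have := hasSum_sum_of_ne_finset_zero (f := fun i => if i ∈ B then c i else 0) (s := B)
        (L := SummationFilter.unconditional _) fun i hi => if_neg hi
      rwa [Finset.sum_ite_mem, Finset.inter_self] at this
  have hmom : HasSum (fun i => ‖gridPoint ρ i‖ ^ 2 * truncWeights B y i)
      (∑ i ∈ B, ‖gridPoint ρ i‖ ^ 2 * (max (y i) 0 / max 1 s)) := by
    refine (hfin fun i => ‖gridPoint ρ i‖ ^ 2 * (max (y i) 0 / max 1 s)).congr_fun fun i => ?_
    rw [truncWeights, ← hs, mul_add, mul_ite, mul_zero, add_eq_left, mul_ite, mul_zero]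
    split_ifs with hi
    · have : gridPoint ρ (0 : Fin d → ℤ) = 0 := by
        ext l; simp [gridPoint]
      rw [hi, this]
      simp
    · rfl
  refine ⟨fun i => add_nonneg ?_ ?_, ?_, hmom.summable, hmom.tsum_eq.le⟩
  · split_ifs
    · exact div_nonneg (le_max_right _ _) hs1.le
    · exact le_rfl
  · split_ifs
    · exact sub_nonneg.2 ((div_le_one hs1).2 (le_max_right _ _))
    · exact le_rfl
  · have h := (hfin fun i => max (y i) 0 / max 1 s).add
      (hasSum_ite_eq (0 : Fin d → ℤ) (1 - s / max 1 s))
    rw [← Finset.sum_div, ← hs, add_sub_cancel] at h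
    exact h

theorem HasMomentLE.mono {d : ℕ} {ρ M M' : ℝ} {w : (Fin d → ℤ) → ℝ} (h : HasMomentLE ρ w M)
    (hM : M ≤ M') : HasMomentLE ρ w M' :=
  { h with tsum_le := h.tsum_le.trans hM }

/-- A bound that depends on `B` but not on `y`; it gives continuity of the truncated scheme on all
of Euclidean space. -/
theorem hasMomentLE_truncWeights_sum {d : ℕ} (ρ : ℝ) (B : Finset (Fin d → ℤ))
    (y : (Fin d → ℤ) → ℝ) :
    HasMomentLE ρ (truncWeights B y) (∑ i ∈ B, ‖gridPoint ρ i‖ ^ 2) := by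
  refine (hasMomentLE_truncWeights ρ B y).mono (Finset.sum_le_sum fun i hi => ?_)
  refine mul_le_of_le_one_right (sq_nonneg _) ((div_le_one ?_).2 ?_)
  · exact lt_of_lt_of_le one_pos (le_max_left _ _)
  · exact (Finset.single_le_sum (f := fun j => max (y j) 0) (fun _ _ => le_max_right _ _) hi).trans
      (le_max_right _ _)

/-- A bound uniform in `B`, needed to let `B` grow. -/
theorem HasMomentLE.truncWeights {d : ℕ} {ρ M : ℝ} {y : (Fin d → ℤ) → ℝ}
    (h : HasMomentLE ρ y M) (B : Finset (Fin d → ℤ)) : HasMomentLE ρ (truncWeights B y) M := by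
  refine (hasMomentLE_truncWeights ρ B y).mono (le_trans (Finset.sum_le_sum fun i hi => ?_)
    ((h.summable.sum_le_tsum B fun i _ => mul_nonneg (sq_nonneg _) (h.nonneg i)).trans h.tsum_le))
  rw [max_eq_left (h.nonneg i)]
  gcongr
  exact div_le_self (h.nonneg i) (le_max_left _ _)

/-- Truncation to growing finite sets is asymptotically the identity under a moment bound. -/
theorem tendsto_truncWeights {d : ℕ} {ρ M : ℝ} (hρ : 0 < ρ) {l : Filter (Finset (Fin d → ℤ))}
    [l.NeBot] (hl : l ≤ atTop) {y : Finset (Fin d → ℤ) → (Fin d → ℤ) → ℝ}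
    {z : (Fin d → ℤ) → ℝ} (hy : ∀ B, HasMomentLE ρ (y B) M)
    (hyz : ∀ i, Tendsto (fun B => y B i) l (𝓝 (z i))) (i : Fin d → ℤ) :
    Tendsto (fun B => truncWeights B (y B) i) l (𝓝 (z i)) := by
  classical
  have hz := HasMomentLE.of_tendsto hρ hy hyz
  have hmem : ∀ i : Fin d → ℤ, ∀ᶠ B in l, i ∈ B := fun i => by
    filter_upwards [hl (eventually_ge_atTop {i})] with B hB
    exact Finset.singleton_subset_iff.1 hB
  have hite : ∀ i, Tendsto (fun B => if i ∈ B then y B i else 0) l (𝓝 (z i)) := fun i =>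
    (hyz i).congr' ((hmem i).mono fun B hB => (if_pos hB).symm)
  have habs : ∀ B i, |if i ∈ B then y B i else 0| ≤ 1 * y B i := fun B i => by
    have := (hy B).nonneg i
    split_ifs
    · rw [abs_of_nonneg this, one_mul]
    · simpa using this
  have hsum := tendsto_tsum_of_moment_le (l := l) (c := fun _ => 1)
    (f := fun B i => if i ∈ B then y B i else 0)
    (fun i => sq_nonneg ‖gridPoint ρ i‖)
    (finite_norm_gridPoint_sq_lt_one hρ) (fun B => (hy B).nonneg) (fun B => (hy B).summable)
    (fun B => (hy B).tsum_le) habs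
    (fun B => Summable.of_norm_bounded (by simpa using (hy B).hasSum.summable) (habs B))
    hz.hasSum.summable hite
  have he : ∀ B : Finset (Fin d → ℤ), ∑' i, (if i ∈ B then y B i else 0) = ∑ i ∈ B, y B i :=
    fun B => by
      rw [tsum_eq_sum (s := B) fun i hi => if_neg hi, Finset.sum_ite_mem, Finset.inter_self]
  simp_rw [he, hz.hasSum.tsum_eq] at hsum
  simp_rw [fun B => truncWeights_of_hasSum B (hy B).nonneg (hy B).hasSum i]
  -- The mass moved to the origin vanishes in the limit, because the mass on `B` tends to the full
  -- mass of `z`.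
  have h0 : Tendsto (fun B => if i = 0 then 1 - ∑ j ∈ B, y B j else 0) l (𝓝 0) := by
    split_ifs
    · simpa using hsum.const_sub 1
    · exact tendsto_const_nhds
  simpa using (hite i).add h0

/-- The array of truncated weights. -/
def truncArray {d N : ℕ} (ρ : ℝ) (B : Finset (Fin d → ℤ)) (y : GridArray d N) :
    gridWeights d N ρ :=
  ⟨fun k => truncWeights B (y k), fun k => (hasMomentLE_truncWeights ρ B (y k)).isGridProb⟩

theorem continuous_truncWeights {X : Type*} [TopologicalSpace X] {d : ℕ} (B : Finset (Fin d → ℤ))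
    {y : X → (Fin d → ℤ) → ℝ} (hy : ∀ i, Continuous fun x => y x i) (i : Fin d → ℤ) :
    Continuous fun x => truncWeights B (y x) i := by
  have hs : Continuous fun x => ∑ j ∈ B, max (y x j) 0 :=
    continuous_finsetSum _ fun j _ => (hy j).max continuous_const
  have hne : ∀ x, max 1 (∑ j ∈ B, max (y x j) 0) ≠ 0 := fun x =>
    (lt_of_lt_of_le one_pos (le_max_left _ _)).ne'
  unfold truncWeights
  refine Continuous.add ?_ ?_
  · split_ifs
    · exact ((hy i).max continuous_const).div (continuous_const.max hs) hne
    · exact continuous_const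
  · split_ifs
    · exact continuous_const.sub (hs.div (continuous_const.max hs) hne)
    · exact continuous_const

/-! ### Fixed points of the truncated and of the full scheme -/

section Scheme

variable {d r N : ℕ} {T ρ : ℝ} (hT : 0 < T)
  {b : Curves d T × Euc d × Set.Icc (0 : ℝ) T → Euc d}
  {σ : Curves d T × Euc d × Set.Icc (0 : ℝ) T → Matrix (Fin d) (Fin r) ℝ}

/-- The truncated scheme has a fixed point, by Brouwer's theorem. -/
theorem exists_truncated_fixedPoint (hr : 0 < r) (hN : 0 < N) (hρ : 0 < ρ)
    (hbσ : AssumptionH b σ) (m₀ : Measure (Euc d)) [IsProbabilityMeasure m₀]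
    (hm : Integrable (fun x => ‖x‖ ^ 2) m₀)
    (hm' : ∀ i : Fin d → ℤ, m₀ (frontier (cube ρ i)) = 0) (B : Finset (Fin d → ℤ)) :
    ∃ m : gridWeights d N ρ, ∀ k,
      (m : GridArray d N) k = truncWeights B (schemeMap hT hN m₀ b σ m k) := by
  classical
  obtain ⟨M, hM⟩ := exists_hasMomentLE_schemeMap hT hr hN hρ hbσ m₀ hm hm'
  let ext : EuclideanSpace ℝ (Fin (N + 1) × B) → GridArray d N :=
    fun x k i => if hi : i ∈ B then x (k, ⟨i, hi⟩) else 0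
  have hext : ∀ k i, Continuous fun x => ext x k i := fun k i => by
    simp only [ext]
    split_ifs
    · fun_prop
    · exact continuous_const
  -- Truncation is applied before the scheme, so the map is defined on the whole space and has
  -- values in `[0, 1]` in each coordinate.
  let Φ : EuclideanSpace ℝ (Fin (N + 1) × B) → EuclideanSpace ℝ (Fin (N + 1) × B) := fun x =>
    WithLp.toLp 2 fun p => schemeMap hT hN m₀ b σ (truncArray ρ B (ext x)) p.1 p.2
  have hΦ : Continuous Φ := by
    refine (PiLp.continuous_toLp 2 _).comp (continuous_pi fun p => ?_)
    rw [continuous_iff_continuousAt]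
    intro x
    exact tendsto_schemeMap hT hr hN hρ hbσ m₀ hm hm'
      (fun x k => hasMomentLE_truncWeights_sum ρ B (ext x k))
      (fun k => hasMomentLE_truncWeights_sum ρ B (ext x k))
      (fun k i => (continuous_truncWeights B (hext k) i).tendsto x) p.1 p.2
  have hbd : ∀ x, ‖Φ x‖ ≤ Real.sqrt (∑ _p : Fin (N + 1) × B, 1) := fun x => by
    rw [EuclideanSpace.norm_eq]
    refine Real.sqrt_le_sqrt (Finset.sum_le_sum fun p _ => ?_)
    have h := hM (truncArray ρ B (ext x)) p.1
    have h0 := h.nonneg p.2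
    have h1 := le_hasSum h.hasSum p.2 fun j _ => h.nonneg j
    rw [Real.norm_of_nonneg h0]
    exact pow_le_one₀ h0 h1
  obtain ⟨x, hx⟩ := Brouwer.exists_fixedPoint_of_bounded hΦ hbd
  -- Truncating the fixed point of the composite turns it into one for the opposite order of
  -- composition; only values on `B` matter.
  refine ⟨truncArray ρ B (ext x), fun k => truncWeights_congr fun i hi => ?_⟩
  simp only [ext, dif_pos hi]
  conv_lhs => rw [← hx]

theorem exists_fixedPoint_schemeMap (hr : 0 < r) (hN : 0 < N) (hρ : 0 < ρ)
    (hbσ : AssumptionH b σ) (m₀ : Measure (Euc d)) [IsProbabilityMeasure m₀]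
    (hm : Integrable (fun x => ‖x‖ ^ 2) m₀)
    (hm' : ∀ i : Fin d → ℤ, m₀ (frontier (cube ρ i)) = 0) :
    ∃ m : gridWeights d N ρ, (m : GridArray d N) = schemeMap hT hN m₀ b σ m := by
  obtain ⟨M, hM⟩ := exists_hasMomentLE_schemeMap hT hr hN hρ hbσ m₀ hm hm'
  choose m hfix using exists_truncated_fixedPoint hT hr hN hρ hbσ m₀ hm hm'
  -- Along an ultrafilter all entries, lying in `[0, 1]`, converge at once, which replaces a
  -- diagonal extraction.
  let U : Ultrafilter (Finset (Fin d → ℤ)) := Ultrafilter.of atTop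
  have hU : (U : Filter (Finset (Fin d → ℤ))) ≤ atTop := Ultrafilter.of_le _
  have hmom : ∀ B k, HasMomentLE ρ ((m B : GridArray d N) k) M := fun B k => by
    rw [hfix B k]
    exact (hM (m B) k).truncWeights B
  have hlim : ∀ k i, ∃ z, Tendsto (fun B => (m B : GridArray d N) k i) U (𝓝 z) := fun k i => by
    obtain ⟨z, -, hz⟩ := (isCompact_Icc (a := (0 : ℝ)) (b := 1)).ultrafilter_le_nhds
      (U.map fun B => (m B : GridArray d N) k i) (by
        rw [le_principal_iff, Ultrafilter.coe_map, mem_map]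
        exact Eventually.of_forall fun B => ⟨(hmom B k).nonneg i,
          le_hasSum (hmom B k).hasSum i fun j _ => (hmom B k).nonneg j⟩)
    exact ⟨z, hz⟩
  choose z hz using hlim
  have hzmom : ∀ k, HasMomentLE ρ (z k) M := fun k =>
    HasMomentLE.of_tendsto hρ (fun B => hmom B k) (hz k)
  let ν : gridWeights d N ρ := ⟨z, fun k => (hzmom k).isGridProb⟩
  have hscheme : ∀ k i, Tendsto (fun B => schemeMap hT hN m₀ b σ (m B) k i) U
      (𝓝 (schemeMap hT hN m₀ b σ ν k i)) :=
    tendsto_schemeMap hT hr hN hρ hbσ m₀ hm hm' hmom (ν := ν) hzmom hz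
  refine ⟨ν, funext fun k => funext fun i => tendsto_nhds_unique (hz k i) ?_⟩
  -- The truncated images tend to the image of `ν`; they are the arrays `m B` themselves, which tend
  -- to `z`.
  have h := tendsto_truncWeights hρ hU (fun B => hM (m B) k) (hscheme k) i
  refine h.congr fun B => ?_
  rw [← hfix B k]

end Scheme

end FPK

end

theorem proposition3p1 (d r N : ℕ) (hr : 0 < r) (hN : 0 < N) (T ρ : ℝ) (hT : 0 < T) (hρ : 0 < ρ)
    (b : FPK.Curves d T × FPK.Euc d × Set.Icc (0 : ℝ) T → FPK.Euc d)
    (σ : FPK.Curves d T × FPK.Euc d × Set.Icc (0 : ℝ) T → Matrix (Fin d) (Fin r) ℝ)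
    (hbσ : FPK.AssumptionH b σ)
    (m₀ : MeasureTheory.Measure (FPK.Euc d)) [MeasureTheory.IsProbabilityMeasure m₀]
    (hm₀_moment : MeasureTheory.Integrable (fun x => ‖x‖ ^ 2) m₀)
    (hm₀_cube : ∀ i : Fin d → ℤ, m₀ (frontier (FPK.cube ρ i)) = 0) :
    (∀ μ : FPK.gridWeights d N ρ, FPK.schemeMap hT hN m₀ b σ μ ∈ FPK.gridWeights d N ρ) ∧
      ∃ m : FPK.gridWeights d N ρ, (m : FPK.GridArray d N) = FPK.schemeMap hT hN m₀ b σ m := by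
  obtain ⟨M, hM⟩ :=
    FPK.exists_hasMomentLE_schemeMap hT hr hN hρ hbσ m₀ hm₀_moment hm₀_cube
  exact ⟨fun μ k => (hM μ k).isGridProb,
    FPK.exists_fixedPoint_schemeMap hT hr hN hρ hbσ m₀ hm₀_moment hm₀_cube⟩
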